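/- **Setting.** Let $T>0$, let $a,a_1,a_2,a_3,f:[0,1]\times\mathbb R\to\mathbb R$ and $r_0,r_1:\mathbb R\to\mathbb R$ be $T$-periodic in $t$, with $a(x,t)>0$ for all $x\in[0,1]$, $t\in\mathbb R$, and $C:=\int_0^T a(0,t)r_0(t)\,dt\neq 0$. Consider $$\partial_t^2w-a^2\partial_x^2w+a_1\partial_tw+a_2\partial_xw+a_3w=f,\qquad w(x,t+T)=w(x,t),\qquad \partial_xw(0,t)=r_0(t)w(0,t),\quad \partial_xw(1,t)=r_1(t)w(1,t).\tag{P}$$ For $0\le n\le\infty$, $C_T^n$ is the space of $n$ times continuously differentiable functions $[0,1]\times\mathbb R\to\mathbb R$ that are $T$-periodic in $t$, and $C_T^n(\mathbb R)$ is the space of $T$-periodic $C^n$ functions $\mathbb R\to\mathbb R$. Put $$b_{11}=\tfrac{a_1}{2}+\tfrac{a_2}{2a}+\tfrac{a\partial_xa-\partial_ta}{2a},\quad b_{12}=\tfrac{a_1}{2}-\tfrac{a_2}{2a}-\tfrac{a\partial_xa-\partial_ta}{2a},\quad b_{21}=\tfrac{a_1}{2}+\tfrac{a_2}{2a}+\tfrac{a\partial_xa+\partial_ta}{2a},\quad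 b_{22}=\tfrac{a_1}{2}-\tfrac{a_2}{2a}-\tfrac{a\partial_xa+\partial_ta}{2a}.$$ For $j=1,2$ and $x\in[0,1]$, $t\in\mathbb R$ let $\xi\in[0,1]\mapsto\tau_j(\xi,x,t)$ be the solution of $\partial_\xi\tau_j(\xi,x,t)=(-1)^j/a(\xi,\tau_j(\xi,x,t))$, $\tau_j(x,x,t)=t$. For $l=0,1,2,\dots$ put $$c_j^l(\xi,x,t)=\exp\int_x^\xi(-1)^j\Big(\frac{b_{jj}}{a}-l\frac{\partial_ta}{a^2}\Big)(\eta,\tau_j(\eta,x,t))\,d\eta,\qquad c_j=c_j^0,\qquad d_j(\xi,x,t)=\frac{(-1)^jc_j(\xi,x,t)}{a(\xi,\tau_j(\xi,x,t))}.$$ For $u=(u_1,u_2)\in C_T^0\times C_T^0$ put $$[Iu](t)=\int_0^t\frac{u_1(0,s)+u_2(0,s)}2\,ds,\qquad [Ju](x,t)=\int_0^x\frac{u_1(\xi,t)-u_2(\xi,t)}{2a(\xi,t)}\,d\xi,$$ $$Nu=\frac1C\int_0^T\Big(\frac{u_1(0,t)-u_2(0,t)}2-a(0,t)r_0(t)[Iu](t)\Big)dt,\qquad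 [Gu](t)=[Iu](t)+Nu,\qquad [Fu](x,t)=[Gu](t)+[Ju](x,t).$$ A *weak solution* of (P) is a function $w(x,t)=[Iu](t)+[Ju](x,t)+Nu$, where $u\in C_T^0\times C_T^0$ satisfies, for all $x\in[0,1]$ and $t\in\mathbb R$, with $\tau_j(\xi)=\tau_j(\xi,x,t)$, $$u_1(x,t)=c_1(0,x,t)\big[u_2(0,\tau_1(0))+2a(0,\tau_1(0))r_0(\tau_1(0))[Gu](\tau_1(0))\big]-\int_0^xd_1(\xi,x,t)\,(b_{12}u_2)(\xi,\tau_1(\xi))\,d\xi+\int_0^xd_1(\xi,x,t)\,(f-a_3Fu)(\xi,\tau_1(\xi))\,d\xi,$$ $$u_2(x,t)=c_2(1,x,t)\big[u_1(1,\tau_2(1))-2a(1,\tau_2(1))r_1(\tau_2(1))[Fu](1,\tau_2(1))\big]-\int_1^xd_2(\xi,x,t)\,(b_{21}u_1)(\xi,\tau_2(\xi))\,d\xi+\int_1^xd_2(\xi,x,t)\,(f-a_3Fu)(\xi,\tau_2(\xi))\,d\xi.$$ **Theorem 1.3.** (i) Let $k\ge1$, $a\in C_T^{k+1}$, $a_1,a_2,a_3,f\in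 C_T^k$, $r_0,r_1\in C_T^k(\mathbb R)$, and let one of the following four conditions hold: - $c_1^l(0,1,t)\,c_2^l(1,0,\tau_1(0,1,t))<1$ for all $t\in\mathbb R$ and $l=0,1,\dots,k$; - $c_1^l(0,1,t)\,c_2^l(1,0,\tau_1(0,1,t))>1$ for all $t\in\mathbb R$ and $l=0,1,\dots,k$; - $c_2^l(1,0,t)\,c_1^l(0,1,\tau_2(1,0,t))<1$ for all $t\in\mathbb R$ and $l=0,1,\dots,k$; - $c_2^l(1,0,t)\,c_1^l(0,1,\tau_2(1,0,t))>1$ for all $t\in\mathbb R$ and $l=0,1,\dots,k$. Then every weak solution of (P) belongs to $C_T^{k+1}$. (ii) Let $a$ be independent of $t$, let $a,a_1,a_2,a_3,f\in C_T^\infty$ and $r_0,r_1\in C_T^\infty(\mathbb R)$, and let one of the following two conditions hold: $$\int_0^1\Big[\Big(\frac{b_{11}}a\Big)(\eta,\tau_1(\eta,1,t))+\Big(\frac{b_{22}}a\Big)(\eta,\tau_2(\eta,0,\tau_1(0,1,t)))\Big]d\eta\ne0\quad\text{for all }t\in\mathbb R,$$ $$\int_0^1\Big[\Big(\frac{b_{22}}a\Big)(\eta,\tau_2(\eta,0,t))+\Big(\frac{b_{11}}a\Big)(\eta,\tau_1(\eta,1,\tau_2(1,0,t)))\Big]d\eta\ne0\quad\text{for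 all }t\in\mathbb R.$$ Then every weak solution of (P) belongs to $C_T^\infty$. -/

import Mathlib

open Set
open scoped ContDiff

noncomputable section

namespace TimePeriodicWave

/-- The data of the time-periodic Robin problem on `[0,1] × ℝ`
`∂ₜ²w - a²∂ₓ²w + a₁∂ₜw + a₂∂ₓw + a₃w = f`, `w(x,t+T) = w(x,t)`,
`∂ₓw(0,t) = r₀(t)w(0,t)`, `∂ₓw(1,t) = r₁(t)w(1,t)`.
Functions on `[0,1] × ℝ` are represented by functions `ℝ → ℝ → ℝ` of `(x,t)`, of which only the
values at `x ∈ [0,1]` are ever used. -/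
structure Data where
  /-- the period -/
  T : ℝ
  /-- the coefficients, functions of `(x,t)` -/
  a : ℝ → ℝ → ℝ
  a₁ : ℝ → ℝ → ℝ
  a₂ : ℝ → ℝ → ℝ
  a₃ : ℝ → ℝ → ℝ
  /-- the right-hand side, a function of `(x,t)` -/
  f : ℝ → ℝ → ℝ
  /-- the boundary coefficients, functions of `t` -/
  r₀ : ℝ → ℝ
  r₁ : ℝ → ℝ

/-- `u ∈ C_T^n`: `u` is `n` times continuously differentiable on the closed strip `[0,1] × ℝ`
and `T`-periodic in `t`. -/
def IsCT (T : ℝ) (n : WithTop ℕ∞) (u : ℝ → ℝ → ℝ) : Prop :=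
  ContDiffOn ℝ n (fun p : ℝ × ℝ => u p.1 p.2) (Icc (0 : ℝ) 1 ×ˢ univ) ∧
    ∀ x ∈ Icc (0 : ℝ) 1, ∀ t : ℝ, u x (t + T) = u x t

/-- `r ∈ C_T^n(ℝ)`: `r` is `n` times continuously differentiable and `T`-periodic. -/
def IsCTReal (T : ℝ) (n : WithTop ℕ∞) (r : ℝ → ℝ) : Prop :=
  ContDiff ℝ n r ∧ ∀ t : ℝ, r (t + T) = r t

/-- `y` solves `y'(ξ) = (-1)^j / a(ξ, y(ξ))` on `[0,1]` with `y(x) = t`. -/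
def IsCharacteristic (a : ℝ → ℝ → ℝ) (j : ℕ) (x t : ℝ) (y : ℝ → ℝ) : Prop :=
  (∀ ξ ∈ Icc (0 : ℝ) 1, HasDerivWithinAt y ((-1 : ℝ) ^ j / a ξ (y ξ)) (Icc 0 1) ξ) ∧ y x = t

namespace Data

variable (P : Data)

/-- `∂ₓa` on `[0,1] × ℝ` (one-sided at `x = 0` and `x = 1`). -/
def ax (x t : ℝ) : ℝ := derivWithin (fun y => P.a y t) (Icc 0 1) x

/-- `∂ₜa`. -/
def at' (x t : ℝ) : ℝ := deriv (fun s => P.a x s) t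

/-! The coefficients `b_{ij}` of the first-order system for
`u₁ = ∂ₜw + a∂ₓw`, `u₂ = ∂ₜw - a∂ₓw`. -/

def b11 (x t : ℝ) : ℝ :=
  P.a₁ x t / 2 + P.a₂ x t / (2 * P.a x t) + (P.a x t * P.ax x t - P.at' x t) / (2 * P.a x t)

def b12 (x t : ℝ) : ℝ :=
  P.a₁ x t / 2 - P.a₂ x t / (2 * P.a x t) - (P.a x t * P.ax x t - P.at' x t) / (2 * P.a x t)

def b21 (x t : ℝ) : ℝ :=
  P.a₁ x t / 2 + P.a₂ x t / (2 * P.a x t) + (P.a x t * P.ax x t + P.at' x t) / (2 * P.a x t)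

def b22 (x t : ℝ) : ℝ :=
  P.a₁ x t / 2 - P.a₂ x t / (2 * P.a x t) - (P.a x t * P.ax x t + P.at' x t) / (2 * P.a x t)

/-- The diagonal coefficient `b_{jj}`, for `j = 1, 2`. -/
def bdiag (j : ℕ) : ℝ → ℝ → ℝ := if j = 1 then P.b11 else P.b22

open Classical in
/-- The characteristic `τ_j(ξ,x,t)`, `j = 1, 2`: the solution of
`∂_ξ τ_j(ξ,x,t) = (-1)^j / a(ξ, τ_j(ξ,x,t))` on `[0,1]` with `τ_j(x,x,t) = t`. For `x ∈ [0,1]` and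
`a > 0` of class `C_T^1` this solution exists and is unique on `[0,1]`. -/
def τ (j : ℕ) (ξ x t : ℝ) : ℝ :=
  if h : ∃ y : ℝ → ℝ, IsCharacteristic P.a j x t y then h.choose ξ else t

/-- `c_j^l(ξ,x,t) = exp ∫_x^ξ (-1)^j (b_{jj}/a - l ∂ₜa/a²)(η, τ_j(η,x,t)) dη`. -/
def cl (l j : ℕ) (ξ x t : ℝ) : ℝ :=
  Real.exp (∫ η in x..ξ, (-1 : ℝ) ^ j *
    (P.bdiag j η (P.τ j η x t) / P.a η (P.τ j η x t)
      - l * (P.at' η (P.τ j η x t) / P.a η (P.τ j η x t) ^ 2)))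

/-- `c_j(ξ,x,t) = exp ∫_x^ξ (-1)^j (b_{jj}/a)(η, τ_j(η,x,t)) dη`. -/
def c (j : ℕ) (ξ x t : ℝ) : ℝ :=
  Real.exp (∫ η in x..ξ, (-1 : ℝ) ^ j * (P.bdiag j η (P.τ j η x t) / P.a η (P.τ j η x t)))

/-- `d_j(ξ,x,t) = (-1)^j c_j(ξ,x,t) / a(ξ, τ_j(ξ,x,t))`. -/
def d (j : ℕ) (ξ x t : ℝ) : ℝ := (-1 : ℝ) ^ j * P.c j ξ x t / P.a ξ (P.τ j ξ x t)

/-- The constant `C = ∫_0^T a(0,t) r₀(t) dt`. -/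
def C : ℝ := ∫ t in (0 : ℝ)..P.T, P.a 0 t * P.r₀ t

/-- `[Iu](t) = ∫_0^t (u₁(0,s) + u₂(0,s))/2 ds`. -/
def opI (u₁ u₂ : ℝ → ℝ → ℝ) (t : ℝ) : ℝ := ∫ s in (0 : ℝ)..t, (u₁ 0 s + u₂ 0 s) / 2

/-- `[Ju](x,t) = ∫_0^x (u₁(ξ,t) - u₂(ξ,t))/(2a(ξ,t)) dξ`. -/
def opJ (u₁ u₂ : ℝ → ℝ → ℝ) (x t : ℝ) : ℝ := ∫ ξ in (0 : ℝ)..x, (u₁ ξ t - u₂ ξ t) / (2 * P.a ξ t)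

/-- `Nu = C⁻¹ ∫_0^T ((u₁(0,t) - u₂(0,t))/2 - a(0,t) r₀(t) [Iu](t)) dt`. -/
def opN (u₁ u₂ : ℝ → ℝ → ℝ) : ℝ :=
  1 / P.C * ∫ t in (0 : ℝ)..P.T, ((u₁ 0 t - u₂ 0 t) / 2 - P.a 0 t * P.r₀ t * opI u₁ u₂ t)

/-- `[Gu](t) = [Iu](t) + Nu`. -/
def opG (u₁ u₂ : ℝ → ℝ → ℝ) (t : ℝ) : ℝ := opI u₁ u₂ t + P.opN u₁ u₂

/-- `[Fu](x,t) = [Gu](t) + [Ju](x,t)`. -/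
def opF (u₁ u₂ : ℝ → ℝ → ℝ) (x t : ℝ) : ℝ := P.opG u₁ u₂ t + P.opJ u₁ u₂ x t

/-- `(u₁,u₂)` is a weak (continuous, `T`-periodic) solution of the first-order system: it satisfies
the two integral equations along the characteristics. -/
structure IsWeakSystemSolution (u₁ u₂ : ℝ → ℝ → ℝ) : Prop where
  mem₁ : IsCT P.T 0 u₁
  mem₂ : IsCT P.T 0 u₂
  eq₁ : ∀ x ∈ Icc (0 : ℝ) 1, ∀ t : ℝ,
    u₁ x t = P.c 1 0 x t * (u₂ 0 (P.τ 1 0 x t)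
        + 2 * P.a 0 (P.τ 1 0 x t) * P.r₀ (P.τ 1 0 x t) * P.opG u₁ u₂ (P.τ 1 0 x t))
      - (∫ ξ in (0 : ℝ)..x, P.d 1 ξ x t * P.b12 ξ (P.τ 1 ξ x t) * u₂ ξ (P.τ 1 ξ x t))
      + ∫ ξ in (0 : ℝ)..x, P.d 1 ξ x t *
          (P.f ξ (P.τ 1 ξ x t) - P.a₃ ξ (P.τ 1 ξ x t) * P.opF u₁ u₂ ξ (P.τ 1 ξ x t))
  eq₂ : ∀ x ∈ Icc (0 : ℝ) 1, ∀ t : ℝ,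
    u₂ x t = P.c 2 1 x t * (u₁ 1 (P.τ 2 1 x t)
        - 2 * P.a 1 (P.τ 2 1 x t) * P.r₁ (P.τ 2 1 x t) * P.opF u₁ u₂ 1 (P.τ 2 1 x t))
      - (∫ ξ in (1 : ℝ)..x, P.d 2 ξ x t * P.b21 ξ (P.τ 2 ξ x t) * u₁ ξ (P.τ 2 ξ x t))
      + ∫ ξ in (1 : ℝ)..x, P.d 2 ξ x t *
          (P.f ξ (P.τ 2 ξ x t) - P.a₃ ξ (P.τ 2 ξ x t) * P.opF u₁ u₂ ξ (P.τ 2 ξ x t))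

/-- `w` is a weak solution of the second-order problem: `w = Iu + Ju + Nu` on `[0,1] × ℝ` for a
weak solution `u = (u₁,u₂)` of the first-order system. -/
def IsWeakSolution (w : ℝ → ℝ → ℝ) : Prop :=
  ∃ u₁ u₂ : ℝ → ℝ → ℝ, P.IsWeakSystemSolution u₁ u₂ ∧
    ∀ x ∈ Icc (0 : ℝ) 1, ∀ t : ℝ, w x t = opI u₁ u₂ t + P.opJ u₁ u₂ x t + P.opN u₁ u₂

/-- `c_1^l(0,1,t) c_2^l(1,0,τ_1(0,1,t))`. -/
def loop₁ (l : ℕ) (t : ℝ) : ℝ := P.cl l 1 0 1 t * P.cl l 2 1 0 (P.τ 1 0 1 t)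

/-- `c_2^l(1,0,t) c_1^l(0,1,τ_2(1,0,t))`. -/
def loop₂ (l : ℕ) (t : ℝ) : ℝ := P.cl l 2 1 0 t * P.cl l 1 0 1 (P.τ 2 1 0 t)

/-- One of the four contraction-type non-resonance conditions holds for all `t` and all
`l = 0, …, k`. -/
def NonResonant (k : ℕ) : Prop :=
  (∀ t : ℝ, ∀ l ≤ k, P.loop₁ l t < 1) ∨ (∀ t : ℝ, ∀ l ≤ k, 1 < P.loop₁ l t) ∨
    (∀ t : ℝ, ∀ l ≤ k, P.loop₂ l t < 1) ∨ (∀ t : ℝ, ∀ l ≤ k, 1 < P.loop₂ l t)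

/-- `∫_0^1 [(b₁₁/a)(η,τ₁(η,1,t)) + (b₂₂/a)(η,τ₂(η,0,τ₁(0,1,t)))] dη ≠ 0` for all `t`. -/
def Small : Prop :=
  ∀ t : ℝ, (∫ η in (0 : ℝ)..1,
    (P.b11 η (P.τ 1 η 1 t) / P.a η (P.τ 1 η 1 t)
      + P.b22 η (P.τ 2 η 0 (P.τ 1 0 1 t)) / P.a η (P.τ 2 η 0 (P.τ 1 0 1 t)))) ≠ 0

/-- `∫_0^1 [(b₂₂/a)(η,τ₂(η,0,t)) + (b₁₁/a)(η,τ₁(η,1,τ₂(1,0,t)))] dη ≠ 0` for all `t`. -/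
def SmallPlus : Prop :=
  ∀ t : ℝ, (∫ η in (0 : ℝ)..1,
    (P.b22 η (P.τ 2 η 0 t) / P.a η (P.τ 2 η 0 t)
      + P.b11 η (P.τ 1 η 1 (P.τ 2 1 0 t)) / P.a η (P.τ 1 η 1 (P.τ 2 1 0 t)))) ≠ 0

end Data

end TimePeriodicWave

end

/-!
Regularity of weak solutions of a time-periodic wave equation with Robin boundary conditions.

Write `u₁ = ∂ₜw + a ∂ₓw`, `u₂ = ∂ₜw - a ∂ₓw`. A weak solution gives a continuous solution `u` of a
diagonal first-order system, whose integral equations say that `u_j` satisfies a transport equation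
along the characteristics with slope `(-1)^j / a`. Going once around the boundary along both families
of characteristics gives a functional equation `p = L·(p ∘ φ) + G` for a boundary trace `p` of `u`;
`L` and `L φ'` are the loop factors of the levels `l = 0` and `l = 1`. If both are below `1`, then
`p` is a series of iterates that may be differentiated termwise, and if both are above `1` the
equation is solved for `p ∘ φ` (`contDiff_of_loop`). Hence `p` is `C^1` as soon as `G` is.

`G` contains integrals of `u` along curves, with `u` merely continuous: of `u₂` along
characteristics of `u₁`, of `u₁` along those of `u₂`, and of both over the vertical segments on which
`Ju` lives. All these curves are transversal to the characteristics of the integrand, and such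
integrals are `C^1` (`Flow.td_integral_transversal`). The reason is a div-curl structure: the
integrand is a directional derivative of a `C^1` function `M` up to harmless terms, and
`∫ B ∂ₓM dx` has a derivative in the parameter for all `C^1` functions `B, M`, since
`dB ∧ dM` involves first derivatives only (`HasPartials.integral_mul_deriv`).

So a continuous solution `u` is `C^1` (`IsSystemSol.hasPartials`). Only `t`-derivatives of the flow
enter: an `x`-derivative follows from the `t`-derivative and the derivative along characteristics
(`hasPartials_of_flow`). The derivative `∂ₜu` solves a system of the same form in which `b_{jj}` is
replaced by `b_{jj} - ∂ₜa/a`, that is, `l` by `l + 1`; induction gives `C^m` regularity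
(`IsSystemSol.cs`). The nonlocal term `Fu = w` has one derivative more than `u`
(`Regular.hasPartials_opF`), so that the right-hand sides never stop the induction.

If `a` does not depend on `t`, all levels share one loop factor, the exponential of the integral
in the hypothesis. That it differs from `1` everywhere means, by continuity, that it stays on one side
of `1`.
-/

namespace TimePeriodicWave

open MeasureTheory Filter Topology

/-! ### Calculus on the strip `[0,1] × ℝ` -/

/-- The closed strip `[0,1] × ℝ`. -/
abbrev strip : Set (ℝ × ℝ) := Icc (0 : ℝ) 1 ×ˢ univ

/-- Joint continuity on the strip of a function of `(x,t)`. -/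
abbrev Cts (F : ℝ → ℝ → ℝ) : Prop := ContinuousOn (fun p : ℝ × ℝ => F p.1 p.2) strip

/-- `C^n` regularity on the strip of a function of `(x,t)`. -/
abbrev CS (n : WithTop ℕ∞) (F : ℝ → ℝ → ℝ) : Prop :=
  ContDiffOn ℝ n (fun p : ℝ × ℝ => F p.1 p.2) strip

/-- `F` is continuous on the strip, with the continuous `t`-derivative `Ft`. Nothing is asked about
the `x`-derivative. -/
structure HasTDeriv (F Ft : ℝ → ℝ → ℝ) : Prop where
  cts : Cts F
  cts' : Cts Ft
  deriv : ∀ x ∈ Icc (0 : ℝ) 1, ∀ t, HasDerivAt (F x) (Ft x t) t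

/-- `F` is continuous on the strip and has a continuous `t`-derivative there. -/
def TD (F : ℝ → ℝ → ℝ) : Prop := ∃ Ft, HasTDeriv F Ft

/-- The retraction of `ℝ` onto `[0,1]`. Composing with it turns functions that are continuous on the
strip into globally continuous ones. -/
noncomputable def clamp (x : ℝ) : ℝ := projIcc (0 : ℝ) 1 zero_le_one x

lemma continuous_clamp : Continuous clamp := continuous_subtype_val.comp continuous_projIcc

lemma clamp_mem (x : ℝ) : clamp x ∈ Icc (0 : ℝ) 1 := (projIcc (0 : ℝ) 1 zero_le_one x).2

lemma clamp_of_mem {x : ℝ} (hx : x ∈ Icc (0 : ℝ) 1) : clamp x = x := by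
  simp [clamp, projIcc_of_mem _ hx]

lemma uIcc_subset_unit {a b : ℝ} (ha : a ∈ Icc (0 : ℝ) 1) (hb : b ∈ Icc (0 : ℝ) 1) :
    uIcc a b ⊆ Icc (0 : ℝ) 1 := uIcc_subset_Icc ha hb

lemma uniqueDiffOn_strip : UniqueDiffOn ℝ strip :=
  (uniqueDiffOn_Icc zero_lt_one).prod uniqueDiffOn_univ

lemma Cts.comp {F Y : ℝ → ℝ → ℝ} (hF : Cts F) (hY : Cts Y) : Cts fun x s => F x (Y x s) :=
  ContinuousOn.comp (f := fun p : ℝ × ℝ => (p.1, Y p.1 p.2)) (t := strip) hF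
    (continuousOn_fst.prodMk hY) fun _ hp => ⟨hp.1, mem_univ _⟩

lemma Cts.slice_left {F : ℝ → ℝ → ℝ} (hF : Cts F) {x₀ : ℝ} (hx₀ : x₀ ∈ Icc (0 : ℝ) 1) :
    Continuous (F x₀) := by
  rw [← continuousOn_univ]
  exact ContinuousOn.comp (f := fun t : ℝ => (x₀, t)) (t := strip) hF (by fun_prop)
    fun _ _ => ⟨hx₀, mem_univ _⟩

lemma Cts.along {F : ℝ → ℝ → ℝ} (hF : Cts F) {y : ℝ → ℝ} (hy : ContinuousOn y (Icc 0 1)) :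
    ContinuousOn (fun x => F x (y x)) (Icc 0 1) :=
  ContinuousOn.comp (f := fun x : ℝ => (x, y x)) (t := strip) hF (continuousOn_id.prodMk hy)
    fun _ hx => ⟨hx, mem_univ _⟩

lemma Cts.slice_right {F : ℝ → ℝ → ℝ} (hF : Cts F) (t : ℝ) :
    ContinuousOn (fun x => F x t) (Icc 0 1) := hF.along continuousOn_const

lemma Cts.extend {F : ℝ → ℝ → ℝ} (hF : Cts F) : Continuous fun p : ℝ × ℝ => F (clamp p.1) p.2 := by
  rw [← continuousOn_univ]
  exact ContinuousOn.comp (f := fun p : ℝ × ℝ => (clamp p.1, p.2)) (t := strip) hF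
    ((continuous_clamp.comp continuous_fst).prodMk continuous_snd).continuousOn
    fun _ _ => ⟨clamp_mem _, mem_univ _⟩

lemma Cts.congr {F G : ℝ → ℝ → ℝ} (hF : Cts F) (h : ∀ x ∈ Icc (0 : ℝ) 1, ∀ t, G x t = F x t) :
    Cts G := ContinuousOn.congr hF fun p hp => h p.1 hp.1 p.2

lemma Cts.const (c : ℝ) : Cts fun _ _ => c := continuousOn_const

lemma Cts.of_time {r : ℝ → ℝ} (hr : Continuous r) : Cts fun _ t => r t :=
  (hr.comp continuous_snd).continuousOn

lemma Cts.exp {F : ℝ → ℝ → ℝ} (hF : Cts F) : Cts fun x t => Real.exp (F x t) :=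
  ContinuousOn.rexp hF

lemma Cts.add {F G : ℝ → ℝ → ℝ} (hF : Cts F) (hG : Cts G) : Cts fun x t => F x t + G x t :=
  ContinuousOn.add hF hG

lemma Cts.sub {F G : ℝ → ℝ → ℝ} (hF : Cts F) (hG : Cts G) : Cts fun x t => F x t - G x t :=
  ContinuousOn.sub hF hG

lemma Cts.mul {F G : ℝ → ℝ → ℝ} (hF : Cts F) (hG : Cts G) : Cts fun x t => F x t * G x t :=
  ContinuousOn.mul hF hG

lemma Cts.neg {F : ℝ → ℝ → ℝ} (hF : Cts F) : Cts fun x t => -F x t :=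
  ContinuousOn.neg hF

lemma intervalIntegrable_of_unit {f : ℝ → ℝ} (hf : ContinuousOn f (Icc 0 1)) {a b : ℝ}
    (ha : a ∈ Icc (0 : ℝ) 1) (hb : b ∈ Icc (0 : ℝ) 1) : IntervalIntegrable f volume a b :=
  (hf.mono (uIcc_subset_unit ha hb)).intervalIntegrable

lemma Cts.integrable {F : ℝ → ℝ → ℝ} (hF : Cts F) {a b : ℝ}
    (ha : a ∈ Icc (0 : ℝ) 1) (hb : b ∈ Icc (0 : ℝ) 1) (t : ℝ) :
    IntervalIntegrable (fun x => F x t) volume a b :=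
  intervalIntegrable_of_unit (hF.slice_right t) ha hb

lemma integral_clamp {F : ℝ → ℝ} {a b : ℝ} (ha : a ∈ Icc (0 : ℝ) 1) (hb : b ∈ Icc (0 : ℝ) 1) :
    ∫ ξ in a..b, F (clamp ξ) = ∫ ξ in a..b, F ξ :=
  intervalIntegral.integral_congr fun ξ hξ => by
    simp only [clamp_of_mem (uIcc_subset_unit ha hb hξ)]

lemma Cts.integral {F : ℝ → ℝ → ℝ} (hF : Cts F) {x₀ : ℝ} (hx₀ : x₀ ∈ Icc (0 : ℝ) 1) :
    Cts fun x s => ∫ ξ in x₀..x, F ξ s := by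
  have h1 : Continuous fun p : ℝ × ℝ => ∫ ξ in x₀..p.1, F (clamp ξ) p.2 :=
    intervalIntegral.continuous_parametric_intervalIntegral_of_continuous
      (f := fun (p : ℝ × ℝ) ξ => F (clamp ξ) p.2)
      (hF.extend.comp (f := fun q : (ℝ × ℝ) × ℝ => (q.2, q.1.2)) (by fun_prop)) continuous_fst
  exact h1.continuousOn.congr fun p hp => (integral_clamp (F := fun ξ => F ξ p.2) hx₀ hp.1).symm

lemma hasDerivWithinAt_integral {f : ℝ → ℝ} (hf : ContinuousOn f (Icc 0 1)) {x₀ x : ℝ}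
    (hx₀ : x₀ ∈ Icc (0 : ℝ) 1) (hx : x ∈ Icc (0 : ℝ) 1) :
    HasDerivWithinAt (fun x => ∫ ξ in x₀..x, f ξ) (f x) (Icc 0 1) x := by
  have hc : Continuous fun ξ => f (clamp ξ) :=
    continuousOn_univ.1 (hf.comp continuous_clamp.continuousOn fun _ _ => clamp_mem _)
  have h1 := (intervalIntegral.integral_hasDerivAt_right (hc.intervalIntegrable x₀ x)
    (hc.stronglyMeasurableAtFilter _ _) hc.continuousAt).hasDerivWithinAt (s := Icc 0 1)
  rw [clamp_of_mem hx] at h1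
  exact h1.congr (fun y hy => (integral_clamp hx₀ hy).symm) (integral_clamp hx₀ hx).symm

/-- The fundamental theorem of calculus with one-sided derivatives at the ends of `[0,1]`. -/
lemma integral_eq_sub_of_unit {f f' : ℝ → ℝ} (hf' : ContinuousOn f' (Icc 0 1))
    (h : ∀ x ∈ Icc (0 : ℝ) 1, HasDerivWithinAt f (f' x) (Icc 0 1) x) {a b : ℝ}
    (ha : a ∈ Icc (0 : ℝ) 1) (hb : b ∈ Icc (0 : ℝ) 1) : ∫ ξ in a..b, f' ξ = f b - f a := by
  have hs := uIcc_subset_unit ha hb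
  refine intervalIntegral.integral_eq_sub_of_hasDeriv_right
    (fun x hx => ((h x (hs hx)).continuousWithinAt.mono hs)) (fun x hx => ?_)
    (intervalIntegrable_of_unit hf' ha hb)
  have hx1 : x ∈ Icc (0 : ℝ) 1 := hs ⟨hx.1.le, hx.2.le⟩
  have hx2 : Icc (0 : ℝ) 1 ∈ 𝓝 x :=
    Icc_mem_nhds ((le_min ha.1 hb.1).trans_lt hx.1) (hx.2.trans_le (max_le ha.2 hb.2))
  exact ((h x hx1).hasDerivAt hx2).hasDerivWithinAt

/-- The mean of `F x ·` over the segment from `t` to `t'`; applied to a `t`-derivative it is the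
difference quotient, in a form that is continuous also at `t = t'`. -/
noncomputable def segMean (F : ℝ → ℝ → ℝ) (x t t' : ℝ) : ℝ := ∫ θ in (0 : ℝ)..1, F x (t + θ * (t' - t))

lemma segMean_self (F : ℝ → ℝ → ℝ) (x t : ℝ) : segMean F x t t = F x t := by simp [segMean]

lemma Cts.segMean {F a b : ℝ → ℝ → ℝ} (hF : Cts F) (ha : Cts a) (hb : Cts b) :
    Cts fun x s => segMean F x (a x s) (b x s) := by
  have h1 : Continuous fun p : ℝ × ℝ => ∫ θ in (0 : ℝ)..1,
      F (clamp p.1) (a (clamp p.1) p.2 + θ * (b (clamp p.1) p.2 - a (clamp p.1) p.2)) := by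
    refine intervalIntegral.continuous_parametric_intervalIntegral_of_continuous'
      (f := fun (p : ℝ × ℝ) θ => F (clamp p.1)
        (a (clamp p.1) p.2 + θ * (b (clamp p.1) p.2 - a (clamp p.1) p.2))) ?_ _ _
    have ha' : Continuous fun q : (ℝ × ℝ) × ℝ => a (clamp q.1.1) q.1.2 :=
      ha.extend.comp continuous_fst
    have hb' : Continuous fun q : (ℝ × ℝ) × ℝ => b (clamp q.1.1) q.1.2 :=
      hb.extend.comp continuous_fst
    exact hF.extend.comp (f := fun q : (ℝ × ℝ) × ℝ => (q.1.1,
      a (clamp q.1.1) q.1.2 + q.2 * (b (clamp q.1.1) q.1.2 - a (clamp q.1.1) q.1.2)))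
      ((continuous_fst.comp continuous_fst).prodMk
        (ha'.add (continuous_snd.mul (hb'.sub ha'))))
  refine h1.continuousOn.congr fun p hp => ?_
  simp only [TimePeriodicWave.segMean, clamp_of_mem hp.1]

lemma HasTDeriv.sub_eq_segMean {F Ft : ℝ → ℝ → ℝ} (h : HasTDeriv F Ft) {x : ℝ}
    (hx : x ∈ Icc (0 : ℝ) 1) (t t' : ℝ) : F x t' - F x t = (t' - t) * segMean Ft x t t' := by
  have h1 : ∀ θ ∈ uIcc (0 : ℝ) 1, HasDerivAt (fun θ => F x (t + θ * (t' - t)))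
      ((t' - t) * Ft x (t + θ * (t' - t))) θ := fun θ _ => by
    have h2 : HasDerivAt (fun θ : ℝ => t + θ * (t' - t)) (t' - t) θ := by
      simpa using ((hasDerivAt_id θ).mul_const (t' - t)).const_add t
    rw [mul_comm]
    exact (h.deriv x hx (t + θ * (t' - t))).comp θ h2
  have hc : Continuous fun θ => (t' - t) * Ft x (t + θ * (t' - t)) :=
    continuous_const.mul ((h.cts'.slice_left hx).comp (by fun_prop))
  have := intervalIntegral.integral_eq_sub_of_hasDerivAt h1 (hc.intervalIntegrable _ _)
  rw [intervalIntegral.integral_const_mul] at this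
  simpa [segMean] using this.symm

/-- A product of a differentiable function that vanishes at `p` and a merely continuous one is
differentiable at `p`. -/
lemma hasFDerivWithinAt_mul_of_eq_zero {E : Type*} [NormedAddCommGroup E] [NormedSpace ℝ E]
    {r m : E → ℝ} {r' : E →L[ℝ] ℝ} {s : Set E} {p : E} (hr : HasFDerivWithinAt r r' s p)
    (h0 : r p = 0) (hm : ContinuousWithinAt m s p) :
    HasFDerivWithinAt (fun z => r z * m z) (m p • r') s p := by
  rw [hasFDerivWithinAt_iff_isLittleO] at hr ⊢
  have hO : r =O[𝓝[s] p] fun z => z - p := by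
    have h1 := hr.isBigO.add (r'.isBigO_sub (𝓝[s] p) p)
    refine h1.congr_left fun z => ?_
    simp [h0]
  have hmo : (fun z => m z - m p) =o[𝓝[s] p] fun _ => (1 : ℝ) := by
    rw [Asymptotics.isLittleO_one_iff]
    simpa using (hm.tendsto.sub_const (m p))
  have h2 := hO.norm_right.mul_isLittleO hmo
  have h3 := hr.const_mul_left (m p)
  have h4 := (h2.congr_right fun z => mul_one _).of_norm_right.add h3
  refine h4.congr_left fun z => ?_
  simp [h0]
  ring

lemma hasDerivAt_mul_of_eq_zero {m : ℝ → ℝ} {s : ℝ} (hm : ContinuousAt m s) :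
    HasDerivAt (fun z => (z - s) * m z) (m s) s := by
  have h := hasFDerivWithinAt_mul_of_eq_zero (r := fun z => z - s) (m := m) (s := univ) (p := s)
    ((hasDerivAt_id s).sub_const s).hasFDerivAt.hasFDerivWithinAt (by simp) hm.continuousWithinAt
  rw [hasFDerivWithinAt_univ] at h
  simpa using h.hasDerivAt

namespace HasTDeriv

variable {F Ft G Gt Y Ys : ℝ → ℝ → ℝ}

lemma congr (h : HasTDeriv F Ft) (hG : ∀ x ∈ Icc (0 : ℝ) 1, ∀ t, G x t = F x t) :
    HasTDeriv G Ft :=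
  ⟨h.cts.congr hG, h.cts', fun x hx t => (h.deriv x hx t).congr_of_eventuallyEq
    (Eventually.of_forall fun s => hG x hx s)⟩

lemma const (c : ℝ) : HasTDeriv (fun _ _ => c) (fun _ _ => 0) :=
  ⟨Cts.const c, Cts.const 0, fun _ _ t => hasDerivAt_const t c⟩

lemma time : HasTDeriv (fun _ t => t) (fun _ _ => 1) :=
  ⟨continuousOn_snd, Cts.const 1, fun _ _ t => hasDerivAt_id t⟩

lemma add (h : HasTDeriv F Ft) (h' : HasTDeriv G Gt) :
    HasTDeriv (fun x t => F x t + G x t) (fun x t => Ft x t + Gt x t) :=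
  ⟨h.cts.add h'.cts, h.cts'.add h'.cts', fun x hx t => (h.deriv x hx t).add (h'.deriv x hx t)⟩

lemma sub (h : HasTDeriv F Ft) (h' : HasTDeriv G Gt) :
    HasTDeriv (fun x t => F x t - G x t) (fun x t => Ft x t - Gt x t) :=
  ⟨h.cts.sub h'.cts, h.cts'.sub h'.cts', fun x hx t => (h.deriv x hx t).sub (h'.deriv x hx t)⟩

lemma neg (h : HasTDeriv F Ft) : HasTDeriv (fun x t => -F x t) (fun x t => -Ft x t) :=
  ⟨h.cts.neg, h.cts'.neg, fun x hx t => (h.deriv x hx t).neg⟩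

lemma mul (h : HasTDeriv F Ft) (h' : HasTDeriv G Gt) :
    HasTDeriv (fun x t => F x t * G x t) (fun x t => Ft x t * G x t + F x t * Gt x t) :=
  ⟨h.cts.mul h'.cts, (h.cts'.mul h'.cts).add (h.cts.mul h'.cts'),
    fun x hx t => (h.deriv x hx t).mul (h'.deriv x hx t)⟩

lemma inv (h : HasTDeriv F Ft) (h0 : ∀ x ∈ Icc (0 : ℝ) 1, ∀ t, F x t ≠ 0) :
    HasTDeriv (fun x t => (F x t)⁻¹) (fun x t => -Ft x t / F x t ^ 2) :=
  ⟨h.cts.inv₀ fun p hp => h0 p.1 hp.1 p.2,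
    h.cts'.neg.div (h.cts.pow 2) fun p hp => pow_ne_zero 2 (h0 p.1 hp.1 p.2),
    fun x hx t => (h.deriv x hx t).inv (h0 x hx t)⟩

lemma exp (h : HasTDeriv F Ft) :
    HasTDeriv (fun x t => Real.exp (F x t)) (fun x t => Real.exp (F x t) * Ft x t) :=
  ⟨h.cts.exp, h.cts.exp.mul h.cts', fun x hx t => (h.deriv x hx t).exp⟩

lemma comp (h : HasTDeriv F Ft) (hY : HasTDeriv Y Ys) :
    HasTDeriv (fun x s => F x (Y x s)) (fun x s => Ft x (Y x s) * Ys x s) :=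
  ⟨h.cts.comp hY.cts, (h.cts'.comp hY.cts).mul hY.cts',
    fun x hx t => (h.deriv x hx _).comp t (hY.deriv x hx t)⟩

/-- Differentiation of `∫ (F(ξ,s') - F(ξ,s)) m(ξ,s') dξ` in `s'` at `s' = s`, for `m` that is merely
continuous. -/
lemma integral_sub_mul (h : HasTDeriv F Ft) {m : ℝ → ℝ → ℝ} (hm : Cts m) {x₀ x : ℝ}
    (hx₀ : x₀ ∈ Icc (0 : ℝ) 1) (hx : x ∈ Icc (0 : ℝ) 1) (s : ℝ) :
    HasDerivAt (fun s' => ∫ ξ in x₀..x, (F ξ s' - F ξ s) * m ξ s')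
      (∫ ξ in x₀..x, Ft ξ s * m ξ s) s := by
  have hc : Cts fun ξ s' => segMean Ft ξ s s' * m ξ s' :=
    (h.cts'.segMean (Cts.const s) HasTDeriv.time.cts).mul hm
  have h1 := hasDerivAt_mul_of_eq_zero (s := s)
    ((hc.integral hx₀).slice_left hx).continuousAt
  simp only [segMean_self] at h1
  refine h1.congr_of_eventuallyEq (Eventually.of_forall fun s' => ?_)
  simp only
  rw [← intervalIntegral.integral_const_mul]
  refine intervalIntegral.integral_congr fun ξ hξ => ?_
  simp only [h.sub_eq_segMean (uIcc_subset_unit hx₀ hx hξ), mul_assoc]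

lemma integral (h : HasTDeriv F Ft) {x₀ : ℝ} (hx₀ : x₀ ∈ Icc (0 : ℝ) 1) :
    HasTDeriv (fun x s => ∫ ξ in x₀..x, F ξ s) (fun x s => ∫ ξ in x₀..x, Ft ξ s) := by
  refine ⟨h.cts.integral hx₀, h.cts'.integral hx₀, fun x hx s => ?_⟩
  have h1 := (h.integral_sub_mul (Cts.const 1) hx₀ hx s).add_const (∫ ξ in x₀..x, F ξ s)
  simp only [mul_one] at h1
  refine h1.congr_of_eventuallyEq (Eventually.of_forall fun s' => ?_)
  simp only
  rw [intervalIntegral.integral_sub (h.cts.integrable hx₀ hx s') (h.cts.integrable hx₀ hx s)]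
  ring

end HasTDeriv

namespace TD

variable {F G Y : ℝ → ℝ → ℝ}

lemma cts (h : TD F) : Cts F := h.choose_spec.cts

lemma congr (h : TD F) (hG : ∀ x ∈ Icc (0 : ℝ) 1, ∀ t, G x t = F x t) : TD G :=
  ⟨_, h.choose_spec.congr hG⟩

lemma add (h : TD F) (h' : TD G) : TD fun x t => F x t + G x t :=
  ⟨_, h.choose_spec.add h'.choose_spec⟩

lemma sub (h : TD F) (h' : TD G) : TD fun x t => F x t - G x t :=
  ⟨_, h.choose_spec.sub h'.choose_spec⟩

lemma neg (h : TD F) : TD fun x t => -F x t := ⟨_, h.choose_spec.neg⟩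

lemma mul (h : TD F) (h' : TD G) : TD fun x t => F x t * G x t :=
  ⟨_, h.choose_spec.mul h'.choose_spec⟩

lemma exp (h : TD F) : TD fun x t => Real.exp (F x t) := ⟨_, h.choose_spec.exp⟩

lemma comp (h : TD F) (hY : TD Y) : TD fun x s => F x (Y x s) :=
  ⟨_, h.choose_spec.comp hY.choose_spec⟩

lemma integral (h : TD F) {x₀ : ℝ} (hx₀ : x₀ ∈ Icc (0 : ℝ) 1) :
    TD fun x s => ∫ ξ in x₀..x, F ξ s := ⟨_, h.choose_spec.integral hx₀⟩

end TD

/-- `F` has the continuous partial derivatives `Fx` (one-sided at `x = 0, 1`) and `Ft`. -/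
structure HasPartials (F Fx Ft : ℝ → ℝ → ℝ) : Prop extends HasTDeriv F Ft where
  ctsx : Cts Fx
  derivx : ∀ x ∈ Icc (0 : ℝ) 1, ∀ t, HasDerivWithinAt (fun ξ => F ξ t) (Fx x t) (Icc 0 1) x

/-- For `B, M` of class `C^1` the integral `∫ B ∂ₓM dξ` is differentiable in `s`, although `∂ₓM` is
not: `dB ∧ dM` involves first derivatives only. In the difference quotient, the increment of `∂ₓM` is
integrated by parts. -/
lemma HasPartials.integral_mul_deriv {B Bx Bs M Mx Ms : ℝ → ℝ → ℝ} (hB : HasPartials B Bx Bs)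
    (hM : HasPartials M Mx Ms) {x₀ : ℝ} (hx₀ : x₀ ∈ Icc (0 : ℝ) 1) :
    HasTDeriv (fun x s => ∫ ξ in x₀..x, B ξ s * Mx ξ s)
      (fun x s => (∫ ξ in x₀..x, Bs ξ s * Mx ξ s) + (B x s * Ms x s - B x₀ s * Ms x₀ s)
        - ∫ ξ in x₀..x, Ms ξ s * Bx ξ s) := by
  have c0 : Cts fun _ s => B x₀ s * Ms x₀ s :=
    Cts.of_time ((hB.cts.slice_left hx₀).mul (hM.cts'.slice_left hx₀))
  refine ⟨(hB.cts.mul hM.ctsx).integral hx₀,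
    (((hB.cts'.mul hM.ctsx).integral hx₀).add ((hB.cts.mul hM.cts').sub c0)).sub
      ((hM.cts'.mul hB.ctsx).integral hx₀), fun x hx s => ?_⟩
  have h1 := hB.toHasTDeriv.integral_sub_mul hM.ctsx hx₀ hx s
  have h2 : ∀ y ∈ Icc (0 : ℝ) 1, HasDerivAt (fun s' => B y s * (M y s' - M y s))
      (B y s * Ms y s) s := fun y hy => ((hM.deriv y hy s).sub_const _).const_mul _
  have h3 := hM.toHasTDeriv.integral_sub_mul (m := fun ξ _ => Bx ξ s)
    (hB.ctsx.comp (Cts.const s)) hx₀ hx s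
  have h4 := ((h1.add ((h2 x hx).sub (h2 x₀ hx₀))).sub h3).add_const
    (∫ ξ in x₀..x, B ξ s * Mx ξ s)
  refine h4.congr_of_eventuallyEq (Eventually.of_forall fun s' => ?_)
  simp only [Pi.add_apply, Pi.sub_apply]
  -- integration by parts of the increment of `Mx`
  have hparts : ∫ ξ in x₀..x, (Bx ξ s * (M ξ s' - M ξ s) + B ξ s * (Mx ξ s' - Mx ξ s)) =
      B x s * (M x s' - M x s) - B x₀ s * (M x₀ s' - M x₀ s) := by
    refine integral_eq_sub_of_unit (f := fun ξ => B ξ s * (M ξ s' - M ξ s))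
      (((hB.ctsx.slice_right s).mul ((hM.cts.slice_right s').sub (hM.cts.slice_right s))).add
        ((hB.cts.slice_right s).mul ((hM.ctsx.slice_right s').sub (hM.ctsx.slice_right s))))
      (fun ξ hξ => ?_) hx₀ hx
    exact (hB.derivx ξ hξ s).mul ((hM.derivx ξ hξ s').sub (hM.derivx ξ hξ s))
  have i1 : IntervalIntegrable (fun ξ => Bx ξ s * (M ξ s' - M ξ s)) volume x₀ x :=
    intervalIntegrable_of_unit ((hB.ctsx.slice_right s).mul
      ((hM.cts.slice_right s').sub (hM.cts.slice_right s))) hx₀ hx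
  have i2 : IntervalIntegrable (fun ξ => B ξ s * (Mx ξ s' - Mx ξ s)) volume x₀ x :=
    intervalIntegrable_of_unit ((hB.cts.slice_right s).mul
      ((hM.ctsx.slice_right s').sub (hM.ctsx.slice_right s))) hx₀ hx
  have i3 : IntervalIntegrable (fun ξ => (B ξ s' - B ξ s) * Mx ξ s') volume x₀ x :=
    intervalIntegrable_of_unit (((hB.cts.slice_right s').sub
      (hB.cts.slice_right s)).mul (hM.ctsx.slice_right s')) hx₀ hx
  have i4 := (hB.cts.mul hM.ctsx).integrable hx₀ hx s
  rw [intervalIntegral.integral_add i1 i2] at hparts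
  have e1 : ∫ ξ in x₀..x, B ξ s' * Mx ξ s' = (∫ ξ in x₀..x, (B ξ s' - B ξ s) * Mx ξ s') +
      (∫ ξ in x₀..x, B ξ s * (Mx ξ s' - Mx ξ s)) + ∫ ξ in x₀..x, B ξ s * Mx ξ s := by
    rw [← intervalIntegral.integral_add i3 i2, ← intervalIntegral.integral_add (i3.add i2) i4]
    exact intervalIntegral.integral_congr fun ξ _ => by ring
  have e2 : ∫ ξ in x₀..x, (M ξ s' - M ξ s) * Bx ξ s = ∫ ξ in x₀..x, Bx ξ s * (M ξ s' - M ξ s) :=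
    intervalIntegral.integral_congr fun ξ _ => by ring
  rw [e1, e2]
  linarith

/-- Partial derivatives along one direction field and in `t` determine the total derivative. Here
`Y` is the flow of `∂ₓ + q ∂ₜ`, with inverse `y`, and `D` is the derivative of `F` along it. -/
lemma hasFDerivWithinAt_of_flow {F Ft D q Y y : ℝ → ℝ → ℝ} (hF : HasTDeriv F Ft)
    (hY : ∀ s, ∀ x ∈ Icc (0 : ℝ) 1, HasDerivWithinAt (fun ξ => Y ξ s) (q x (Y x s)) (Icc 0 1) x)
    (hinv : ∀ x ∈ Icc (0 : ℝ) 1, ∀ t, Y x (y x t) = t)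
    (hD : ∀ s, ∀ x ∈ Icc (0 : ℝ) 1,
      HasDerivWithinAt (fun ξ => F ξ (Y ξ s)) (D x (Y x s)) (Icc 0 1) x)
    {x : ℝ} (hx : x ∈ Icc (0 : ℝ) 1) (t : ℝ) :
    HasFDerivWithinAt (fun p : ℝ × ℝ => F p.1 p.2)
      ((D x t - q x t * Ft x t) • ContinuousLinearMap.fst ℝ ℝ ℝ +
        Ft x t • ContinuousLinearMap.snd ℝ ℝ ℝ) strip (x, t) := by
  obtain ⟨s, hs⟩ : ∃ s, Y x s = t := ⟨y x t, hinv x hx t⟩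
  have hfst : HasFDerivWithinAt (fun p : ℝ × ℝ => p.1) (ContinuousLinearMap.fst ℝ ℝ ℝ) strip (x, t) :=
    hasFDerivWithinAt_fst
  have hsnd : HasFDerivWithinAt (fun p : ℝ × ℝ => p.2) (ContinuousLinearMap.snd ℝ ℝ ℝ) strip (x, t) :=
    hasFDerivWithinAt_snd
  have hmaps : MapsTo (fun p : ℝ × ℝ => p.1) strip (Icc 0 1) := fun p hp => hp.1
  have h1 : HasFDerivWithinAt (fun p : ℝ × ℝ => F p.1 (Y p.1 s))
      (D x (Y x s) • ContinuousLinearMap.fst ℝ ℝ ℝ) strip (x, t) :=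
    HasDerivWithinAt.comp_hasFDerivWithinAt (h₂ := fun ξ => F ξ (Y ξ s)) (x, t) (hD s x hx) hfst hmaps
  have h2 : HasFDerivWithinAt (fun p : ℝ × ℝ => Y p.1 s)
      (q x (Y x s) • ContinuousLinearMap.fst ℝ ℝ ℝ) strip (x, t) :=
    HasDerivWithinAt.comp_hasFDerivWithinAt (h₂ := fun ξ => Y ξ s) (x, t) (hY s x hx) hfst hmaps
  have hYc : Cts fun ξ _ => Y ξ s :=
    ContinuousOn.comp (g := fun ξ => Y ξ s) (fun ξ hξ => (hY s ξ hξ).continuousWithinAt)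
      continuousOn_fst hmaps
  have hm : ContinuousWithinAt (fun p : ℝ × ℝ => segMean Ft p.1 (Y p.1 s) p.2) strip (x, t) :=
    (hF.cts'.segMean hYc HasTDeriv.time.cts) (x, t) ⟨hx, mem_univ _⟩
  have h3 := h1.add (hasFDerivWithinAt_mul_of_eq_zero (hsnd.sub h2) (by simp [hs]) hm)
  simp only [hs, segMean_self] at h3
  refine HasFDerivWithinAt.congr' (h3.congr_fderiv ?_) (fun p hp => ?_) ⟨hx, mem_univ _⟩
  · ext <;> simp
    ring
  · have := hF.sub_eq_segMean hp.1 (Y p.1 s) p.2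
    simp only [Pi.add_apply, Pi.sub_apply]
    linarith

lemma HasPartials.hasFDerivWithinAt {F Fx Ft : ℝ → ℝ → ℝ} (h : HasPartials F Fx Ft)
    {x : ℝ} (hx : x ∈ Icc (0 : ℝ) 1) (t : ℝ) :
    HasFDerivWithinAt (fun p : ℝ × ℝ => F p.1 p.2)
      (Fx x t • ContinuousLinearMap.fst ℝ ℝ ℝ + Ft x t • ContinuousLinearMap.snd ℝ ℝ ℝ)
      strip (x, t) := by
  have := hasFDerivWithinAt_of_flow (F := F) (Ft := Ft) (D := Fx) (q := fun _ _ => 0)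
    (Y := fun _ s => s) (y := fun _ s => s) h.toHasTDeriv
    (fun s x _ => hasDerivWithinAt_const _ _ _) (fun _ _ _ => rfl) (fun s x hx => h.derivx x hx s)
    hx t
  simpa using this

lemma hasPartials_of_flow {F Ft D q Y y : ℝ → ℝ → ℝ} (hF : HasTDeriv F Ft)
    (hY : ∀ s, ∀ x ∈ Icc (0 : ℝ) 1, HasDerivWithinAt (fun ξ => Y ξ s) (q x (Y x s)) (Icc 0 1) x)
    (hinv : ∀ x ∈ Icc (0 : ℝ) 1, ∀ t, Y x (y x t) = t)
    (hD : ∀ s, ∀ x ∈ Icc (0 : ℝ) 1,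
      HasDerivWithinAt (fun ξ => F ξ (Y ξ s)) (D x (Y x s)) (Icc 0 1) x)
    (hq : Cts q) (hDc : Cts D) : HasPartials F (fun x t => D x t - q x t * Ft x t) Ft where
  toHasTDeriv := hF
  ctsx := hDc.sub (hq.mul hF.cts')
  derivx x hx t := by
    have h := hasFDerivWithinAt_of_flow hF hY hinv hD hx t
    have h2 : HasDerivWithinAt (fun ξ : ℝ => (ξ, t)) (1, 0) (Icc 0 1) x :=
      (hasDerivWithinAt_id x _).prodMk (hasDerivWithinAt_const x _ t)
    exact (h.comp_hasDerivWithinAt (f := fun ξ : ℝ => (ξ, t)) (t := strip) x h2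
      fun ξ hξ => ⟨hξ, mem_univ _⟩).congr_deriv (by simp)

/-- The chain rule along a graph `t = γ(x)`. -/
lemma HasPartials.hasDerivWithinAt_along {F Fx Ft : ℝ → ℝ → ℝ} (h : HasPartials F Fx Ft)
    {γ : ℝ → ℝ} {γ' x : ℝ} (hx : x ∈ Icc (0 : ℝ) 1) (hγ : HasDerivWithinAt γ γ' (Icc 0 1) x) :
    HasDerivWithinAt (fun ξ => F ξ (γ ξ)) (Fx x (γ x) + Ft x (γ x) * γ') (Icc 0 1) x := by
  have h2 : HasDerivWithinAt (fun ξ : ℝ => (ξ, γ ξ)) (1, γ') (Icc 0 1) x :=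
    (hasDerivWithinAt_id x _).prodMk hγ
  exact ((h.hasFDerivWithinAt hx (γ x)).comp_hasDerivWithinAt (f := fun ξ : ℝ => (ξ, γ ξ))
    (t := strip) x h2 fun ξ hξ => ⟨hξ, mem_univ _⟩).congr_deriv (by simp)

lemma HasPartials.comp {F Fx Ft Y Yx Ys : ℝ → ℝ → ℝ} (h : HasPartials F Fx Ft)
    (hY : HasPartials Y Yx Ys) :
    HasPartials (fun x s => F x (Y x s)) (fun x s => Fx x (Y x s) + Ft x (Y x s) * Yx x s)
      (fun x s => Ft x (Y x s) * Ys x s) where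
  toHasTDeriv := h.toHasTDeriv.comp hY.toHasTDeriv
  ctsx := (h.ctsx.comp hY.cts).add ((h.cts'.comp hY.cts).mul hY.ctsx)
  derivx x hx t := h.hasDerivWithinAt_along hx (hY.derivx x hx t)

namespace CS

variable {n : WithTop ℕ∞} {F G : ℝ → ℝ → ℝ}

lemma cts (h : CS n F) : Cts F := ContDiffOn.continuousOn h

lemma zero_iff : CS 0 F ↔ Cts F := contDiffOn_zero

lemma mono {m : WithTop ℕ∞} (h : CS n F) (hm : m ≤ n) : CS m F := ContDiffOn.of_le h hm

lemma congr (h : CS n F) (hG : ∀ x ∈ Icc (0 : ℝ) 1, ∀ t, G x t = F x t) : CS n G :=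
  ContDiffOn.congr h fun p hp => hG p.1 hp.1 p.2

lemma const (c : ℝ) : CS n fun _ _ => c := contDiffOn_const

lemma add (h : CS n F) (h' : CS n G) : CS n fun x t => F x t + G x t := ContDiffOn.add h h'

lemma sub (h : CS n F) (h' : CS n G) : CS n fun x t => F x t - G x t := ContDiffOn.sub h h'

lemma neg (h : CS n F) : CS n fun x t => -F x t := ContDiffOn.neg h

lemma mul (h : CS n F) (h' : CS n G) : CS n fun x t => F x t * G x t := ContDiffOn.mul h h'

lemma div (h : CS n F) (h' : CS n G) (h0 : ∀ x ∈ Icc (0 : ℝ) 1, ∀ t, G x t ≠ 0) :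
    CS n fun x t => F x t / G x t := ContDiffOn.div h h' fun p hp => h0 p.1 hp.1 p.2

lemma of_time {r : ℝ → ℝ} (h : ContDiff ℝ n r) : CS n fun _ t => r t :=
  (h.comp contDiff_snd).contDiffOn

lemma slice (h : CS n F) {x : ℝ} (hx : x ∈ Icc (0 : ℝ) 1) : ContDiff ℝ n (F x) := by
  rw [← contDiffOn_univ]
  exact ContDiffOn.comp (f := fun t : ℝ => (x, t)) (t := strip) h
    (contDiff_const.prodMk contDiff_id).contDiffOn fun _ _ => ⟨hx, mem_univ _⟩

end CS

/-- The derivative in `t` of a function of `(x,t)`. -/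
noncomputable def dT (F : ℝ → ℝ → ℝ) (x t : ℝ) : ℝ := deriv (fun s => F x s) t

/-- The derivative in `x` of a function on the strip, one-sided at `x = 0, 1`. -/
noncomputable def dX (F : ℝ → ℝ → ℝ) (x t : ℝ) : ℝ := derivWithin (fun y => F y t) (Icc 0 1) x

section

variable {n : WithTop ℕ∞} {F Fx Ft : ℝ → ℝ → ℝ}

lemma CS.fderivWithin_apply (h : CS 1 F) {x : ℝ} (hx : x ∈ Icc (0 : ℝ) 1) (t : ℝ) :
    HasDerivWithinAt (fun ξ => F ξ t)
      (fderivWithin ℝ (fun p : ℝ × ℝ => F p.1 p.2) strip (x, t) (1, 0)) (Icc 0 1) x ∧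
    HasDerivAt (F x) (fderivWithin ℝ (fun p : ℝ × ℝ => F p.1 p.2) strip (x, t) (0, 1)) t := by
  have h1 := ((ContDiffOn.differentiableOn h one_ne_zero) (x, t)
    ⟨hx, mem_univ _⟩).hasFDerivWithinAt
  constructor
  · exact h1.comp_hasDerivWithinAt (f := fun ξ : ℝ => (ξ, t)) (t := strip) x
      ((hasDerivWithinAt_id x _).prodMk (hasDerivWithinAt_const x _ t))
      fun ξ hξ => ⟨hξ, mem_univ _⟩
  · rw [← hasDerivWithinAt_univ]
    exact h1.comp_hasDerivWithinAt (f := fun s : ℝ => (x, s)) (t := strip) t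
      ((hasDerivWithinAt_const t _ x).prodMk (hasDerivWithinAt_id t _))
      fun s _ => ⟨hx, mem_univ _⟩

lemma CS.dT_eq (h : CS 1 F) {x : ℝ} (hx : x ∈ Icc (0 : ℝ) 1) (t : ℝ) :
    dT F x t = fderivWithin ℝ (fun p : ℝ × ℝ => F p.1 p.2) strip (x, t) (0, 1) :=
  (h.fderivWithin_apply hx t).2.deriv

lemma CS.dX_eq (h : CS 1 F) {x : ℝ} (hx : x ∈ Icc (0 : ℝ) 1) (t : ℝ) :
    dX F x t = fderivWithin ℝ (fun p : ℝ × ℝ => F p.1 p.2) strip (x, t) (1, 0) :=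
  (h.fderivWithin_apply hx t).1.derivWithin (uniqueDiffOn_Icc zero_lt_one x hx)

lemma CS.dT (h : CS (n + 1) F) : CS n (dT F) :=
  (((ContDiffOn.fderivWithin h uniqueDiffOn_strip le_rfl).clm_apply
    (contDiffOn_const (c := ((0 : ℝ), (1 : ℝ)))))).congr fun p hp =>
      (h.mono le_add_self).dT_eq hp.1 p.2

lemma CS.dX (h : CS (n + 1) F) : CS n (dX F) :=
  (((ContDiffOn.fderivWithin h uniqueDiffOn_strip le_rfl).clm_apply
    (contDiffOn_const (c := ((1 : ℝ), (0 : ℝ)))))).congr fun p hp =>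
      (h.mono le_add_self).dX_eq hp.1 p.2

lemma CS.hasPartials (h : CS 1 F) :
    HasPartials F (TimePeriodicWave.dX F) (TimePeriodicWave.dT F) where
  cts := h.cts
  cts' := (CS.dT (n := 0) (by simpa using h)).cts
  deriv x hx t := by rw [h.dT_eq hx t]; exact (h.fderivWithin_apply hx t).2
  ctsx := (CS.dX (n := 0) (by simpa using h)).cts
  derivx x hx t := by rw [h.dX_eq hx t]; exact (h.fderivWithin_apply hx t).1

lemma CS.td (h : CS 1 F) : TD F := ⟨_, h.hasPartials.toHasTDeriv⟩

lemma HasPartials.cs_succ (h : HasPartials F Fx Ft) {n : ℕ} (hx : CS n Fx) (ht : CS n Ft) :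
    CS (n + 1 : ℕ) F := by
  have := (contDiffOn_succ_iff_hasFDerivWithinAt_of_uniqueDiffOn (n := (n : WithTop ℕ∞))
    (f := fun p : ℝ × ℝ => F p.1 p.2) uniqueDiffOn_strip).2
    ⟨fun h => absurd h (WithTop.coe_ne_top), fun p => Fx p.1 p.2 • ContinuousLinearMap.fst ℝ ℝ ℝ +
      Ft p.1 p.2 • ContinuousLinearMap.snd ℝ ℝ ℝ,
      (ContDiffOn.smul hx contDiffOn_const).add (ContDiffOn.smul ht contDiffOn_const),
      fun p hp => h.hasFDerivWithinAt hp.1 p.2⟩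
  exact_mod_cast this

lemma HasPartials.cs (h : HasPartials F Fx Ft) : CS 1 F := by
  have := h.cs_succ (n := 0) (by simpa using CS.zero_iff.2 h.ctsx)
    (by simpa using CS.zero_iff.2 h.cts')
  simpa using this

lemma HasTDeriv.dT_eq (h : HasTDeriv F Ft) {x : ℝ} (hx : x ∈ Icc (0 : ℝ) 1) (t : ℝ) :
    TimePeriodicWave.dT F x t = Ft x t := (h.deriv x hx t).deriv

lemma TD.hasTDeriv (h : TD F) : HasTDeriv F (TimePeriodicWave.dT F) := by
  obtain ⟨Ft, h⟩ := h
  exact ⟨h.cts, h.cts'.congr fun x hx t => h.dT_eq hx t, fun x hx t => by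
    rw [h.dT_eq hx t]; exact h.deriv x hx t⟩

lemma hasTDeriv_integral_time {V : ℝ → ℝ → ℝ} (hV : Cts V) :
    HasTDeriv (fun x s => ∫ σ in (0 : ℝ)..s, V x σ) V := by
  refine ⟨?_, hV, fun x hx t => ?_⟩
  · have h1 : Continuous fun p : ℝ × ℝ => ∫ σ in (0 : ℝ)..p.2, V (clamp p.1) σ :=
      intervalIntegral.continuous_parametric_intervalIntegral_of_continuous
        (f := fun (p : ℝ × ℝ) σ => V (clamp p.1) σ)
        (hV.extend.comp (f := fun q : (ℝ × ℝ) × ℝ => (q.1.1, q.2)) (by fun_prop)) continuous_snd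
    exact h1.continuousOn.congr fun p hp => by simp only [clamp_of_mem hp.1]
  · exact intervalIntegral.integral_hasDerivAt_right ((hV.slice_left hx).intervalIntegrable _ _)
      ((hV.slice_left hx).stronglyMeasurableAtFilter _ _) (hV.slice_left hx).continuousAt

/-- Differentiation of a time integral in the parameter `x`. -/
lemma hasPartials_integral_time {V Vx : ℝ → ℝ → ℝ} (hV : Cts V) (hVx : Cts Vx)
    (h : ∀ x ∈ Icc (0 : ℝ) 1, ∀ t, HasDerivWithinAt (fun ξ => V ξ t) (Vx x t) (Icc 0 1) x) :
    HasPartials (fun x s => ∫ σ in (0 : ℝ)..s, V x σ) (fun x s => ∫ σ in (0 : ℝ)..s, Vx x σ) V := by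
  have hc := (hasTDeriv_integral_time hVx).cts
  refine ⟨hasTDeriv_integral_time hV, hc, fun x hx s => ?_⟩
  have h0 : (0 : ℝ) ∈ Icc (0 : ℝ) 1 := ⟨le_rfl, zero_le_one⟩
  have h1 := (hasDerivWithinAt_integral ((hc).slice_right s) h0 hx).add_const
    (∫ σ in (0 : ℝ)..s, V 0 σ)
  have key : ∀ ξ ∈ Icc (0 : ℝ) 1, ∫ σ in (0 : ℝ)..s, V ξ σ =
      (∫ η in (0 : ℝ)..ξ, ∫ σ in (0 : ℝ)..s, Vx η σ) + ∫ σ in (0 : ℝ)..s, V 0 σ := fun ξ hξ => by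
    have e : ∀ σ, V ξ σ = (∫ η in (0 : ℝ)..ξ, Vx η σ) + V 0 σ := fun σ => by
      rw [integral_eq_sub_of_unit (hVx.slice_right σ) (fun x hx => h x hx σ) h0 hξ]
      ring
    have i1 : Continuous fun σ => ∫ η in (0 : ℝ)..ξ, Vx η σ := (hVx.integral h0).slice_left hξ
    simp_rw [e]
    rw [intervalIntegral.integral_add (i1.intervalIntegrable _ _)
      ((hV.slice_left h0).intervalIntegrable _ _)]
    congr 1
    have hc2 : Continuous (Function.uncurry fun σ η => Vx (clamp η) σ) :=
      hVx.extend.comp (f := fun q : ℝ × ℝ => (q.2, q.1)) (by fun_prop)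
    have sw := intervalIntegral_intervalIntegral_swap (F := fun σ η => Vx (clamp η) σ)
      (a := 0) (b := s) (c := 0) (d := ξ)
      ((hc2.continuousOn.integrableOn_compact (isCompact_uIcc.prod isCompact_uIcc)).mono_set
        (prod_mono uIoc_subset_uIcc uIoc_subset_uIcc))
    have l1 : ∀ σ, ∫ η in (0 : ℝ)..ξ, Vx (clamp η) σ = ∫ η in (0 : ℝ)..ξ, Vx η σ := fun σ =>
      integral_clamp (F := fun η => Vx η σ) h0 hξ
    have l2 := integral_clamp (F := fun η => ∫ σ in (0 : ℝ)..s, Vx η σ) h0 hξ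
    simp_rw [l1] at sw
    rw [sw, l2]
  exact h1.congr key (key x hx)

end

/-! ### Flows of the characteristic equations -/

/-- Variation of constants for a scalar linear equation on `[0,1]`. -/
lemma linear_ode_eq {f A B : ℝ → ℝ} (hA : ContinuousOn A (Icc 0 1)) (hB : ContinuousOn B (Icc 0 1))
    (hf : ∀ x ∈ Icc (0 : ℝ) 1, HasDerivWithinAt f (A x * f x + B x) (Icc 0 1) x) {x₀ x : ℝ}
    (hx₀ : x₀ ∈ Icc (0 : ℝ) 1) (hx : x ∈ Icc (0 : ℝ) 1) :
    f x = Real.exp (∫ η in x₀..x, A η) *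
      (f x₀ + ∫ ξ in x₀..x, Real.exp (-∫ η in x₀..ξ, A η) * B ξ) := by
  have hE : ∀ x ∈ Icc (0 : ℝ) 1, HasDerivWithinAt (fun x => Real.exp (-∫ η in x₀..x, A η))
      (Real.exp (-∫ η in x₀..x, A η) * -A x) (Icc 0 1) x := fun x hx =>
    (hasDerivWithinAt_integral hA hx₀ hx).neg.exp
  have h1 := integral_eq_sub_of_unit (f := fun x => Real.exp (-∫ η in x₀..x, A η) * f x)
    (f' := fun x => Real.exp (-∫ η in x₀..x, A η) * B x)
    (ContinuousOn.mul (fun x hx => (hE x hx).continuousWithinAt) hB)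
    (fun x hx => ((hE x hx).mul (hf x hx)).congr_deriv (by ring)) hx₀ hx
  simp only [intervalIntegral.integral_same, neg_zero, Real.exp_zero, one_mul] at h1
  rw [h1, add_sub_cancel, ← mul_assoc, ← Real.exp_add, add_neg_cancel, Real.exp_zero, one_mul]

/-- `y` solves `y' = q(ξ,y)` on `[0,1]`. -/
def IsSol (q : ℝ → ℝ → ℝ) (y : ℝ → ℝ) : Prop :=
  ∀ ξ ∈ Icc (0 : ℝ) 1, HasDerivWithinAt y (q ξ (y ξ)) (Icc 0 1) ξ

section Solutions

variable {q : ℝ → ℝ → ℝ} {y z : ℝ → ℝ}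

lemma IsSol.continuousOn (hy : IsSol q y) : ContinuousOn y (Icc 0 1) :=
  fun ξ hξ => (hy ξ hξ).continuousWithinAt

lemma cts_of_continuousOn (hy : ContinuousOn y (Icc 0 1)) : Cts fun x _ => y x :=
  ContinuousOn.comp hy continuousOn_fst fun _ hp => hp.1

lemma IsSol.cts (hy : IsSol q y) : Cts fun x _ => y x := cts_of_continuousOn hy.continuousOn

/-- The difference of two solutions solves a linear equation. -/
lemma IsSol.sub_eq (hq : CS 1 q) (hy : IsSol q y) (hz : IsSol q z) {x₀ x : ℝ}
    (hx₀ : x₀ ∈ Icc (0 : ℝ) 1) (hx : x ∈ Icc (0 : ℝ) 1) :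
    z x - y x = (z x₀ - y x₀) * Real.exp (∫ η in x₀..x, segMean (dT q) η (y η) (z η)) := by
  have h := linear_ode_eq (f := fun x => z x - y x) (A := fun η => segMean (dT q) η (y η) (z η))
    (B := fun _ => 0) ((hq.hasPartials.cts'.segMean hy.cts hz.cts).slice_right 0)
    continuousOn_const (fun x hx => by
      have h1 := hq.hasPartials.toHasTDeriv.sub_eq_segMean hx (y x) (z x)
      exact ((hz x hx).sub (hy x hx)).congr_deriv (by linarith)) hx₀ hx
  simp only [mul_zero, intervalIntegral.integral_zero, add_zero] at h
  rw [h, mul_comm]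

lemma IsSol.eq_of_eq (hq : CS 1 q) (hy : IsSol q y) (hz : IsSol q z) {x₀ x : ℝ}
    (hx₀ : x₀ ∈ Icc (0 : ℝ) 1) (h : y x₀ = z x₀) (hx : x ∈ Icc (0 : ℝ) 1) : y x = z x := by
  have := hy.sub_eq hq hz hx₀ hx
  rw [h, sub_self, zero_mul] at this
  linarith

lemma abs_segMean_le {F : ℝ → ℝ → ℝ} {K : ℝ} (hK : ∀ x ∈ Icc (0 : ℝ) 1, ∀ t, |F x t| ≤ K) {x : ℝ}
    (hx : x ∈ Icc (0 : ℝ) 1) (t t' : ℝ) : |segMean F x t t'| ≤ K := by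
  have := intervalIntegral.norm_integral_le_of_norm_le_const (a := (0 : ℝ)) (b := 1)
    (f := fun θ => F x (t + θ * (t' - t))) (C := K) fun θ _ => hK x hx _
  simpa [segMean] using this

lemma IsSol.abs_sub_le (hq : CS 1 q) {K : ℝ} (hK : ∀ x ∈ Icc (0 : ℝ) 1, ∀ t, |dT q x t| ≤ K)
    (hy : IsSol q y) (hz : IsSol q z) {x₀ x : ℝ}
    (hx₀ : x₀ ∈ Icc (0 : ℝ) 1) (hx : x ∈ Icc (0 : ℝ) 1) :
    |z x - y x| ≤ Real.exp K * |z x₀ - y x₀| := by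
  have hK0 : 0 ≤ K := (abs_nonneg _).trans (hK x hx 0)
  rw [hy.sub_eq hq hz hx₀ hx, abs_mul, mul_comm, abs_of_pos (Real.exp_pos _)]
  gcongr
  have h1 := intervalIntegral.norm_integral_le_of_norm_le_const (a := x₀) (b := x)
    (f := fun η => segMean (dT q) η (y η) (z η)) (C := K) fun η hη =>
      abs_segMean_le hK (uIcc_subset_unit hx₀ hx (uIoc_subset_uIcc hη)) _ _
  have h2 : |x - x₀| ≤ 1 := abs_le.2 ⟨by linarith [hx.1, hx₀.2], by linarith [hx.2, hx₀.1]⟩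
  calc _ ≤ |∫ η in x₀..x, segMean (dT q) η (y η) (z η)| := le_abs_self _
    _ ≤ K * |x - x₀| := h1
    _ ≤ K := by nlinarith

lemma IsSol.abs_sub_le_mul {M : ℝ} (hM : ∀ x ∈ Icc (0 : ℝ) 1, ∀ t, |q x t| ≤ M) (hy : IsSol q y)
    {x x' : ℝ} (hx : x ∈ Icc (0 : ℝ) 1) (hx' : x' ∈ Icc (0 : ℝ) 1) :
    |y x' - y x| ≤ M * |x' - x| :=
  (convex_Icc (0 : ℝ) 1).norm_image_sub_le_of_norm_hasDerivWithin_le (fun ξ hξ => hy ξ hξ)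
    (fun ξ hξ => hM ξ hξ _) hx hx'

lemma exists_isSol (hq : CS 1 q) {M K : ℝ} (hM : ∀ x ∈ Icc (0 : ℝ) 1, ∀ t, |q x t| ≤ M)
    (hK : ∀ x ∈ Icc (0 : ℝ) 1, ∀ t, |dT q x t| ≤ K) {x₀ : ℝ} (hx₀ : x₀ ∈ Icc (0 : ℝ) 1) (t : ℝ) :
    ∃ y, y x₀ = t ∧ IsSol q y := by
  have h0 : (0 : ℝ) ∈ Icc (0 : ℝ) 1 := ⟨le_rfl, zero_le_one⟩
  have hK0 : 0 ≤ K := (abs_nonneg _).trans (hK 0 h0 0)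
  have hM0 : 0 ≤ M := (abs_nonneg _).trans (hM 0 h0 0)
  have hpl : IsPicardLindelof q (tmin := 0) (tmax := 1) ⟨x₀, hx₀⟩ t ⟨M, hM0⟩ 0 ⟨M, hM0⟩ ⟨K, hK0⟩ := by
    refine ⟨fun x hx => ?_, fun s _ => hq.cts.slice_right s, fun x hx s _ => hM x hx s, ?_⟩
    · refine LipschitzOnWith.of_dist_le_mul fun s _ s' _ => ?_
      rw [Real.dist_eq, hq.hasPartials.toHasTDeriv.sub_eq_segMean hx s' s, abs_mul, mul_comm,
        Real.dist_eq]
      exact mul_le_mul_of_nonneg_right (abs_segMean_le hK hx _ _) (abs_nonneg _)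
    · have : max (1 - x₀) (x₀ - 0) ≤ 1 := max_le (by linarith [hx₀.1]) (by linarith [hx₀.2])
      have h := mul_le_of_le_one_right hM0 this
      simp only [NNReal.coe_zero, sub_zero] at h ⊢
      exact h
  exact hpl.exists_eq_forall_mem_Icc_hasDerivWithinAt₀

end Solutions

/-- The flow of `∂ₓ + q ∂ₜ` on the strip: `Y(·,s)` is the solution of `y' = q(ξ,y)` with
`y(x₀) = s`, `y` is the inverse of `Y` in the time variable (so `y(x,t)` is the label of the
characteristic through `(x,t)`), and `Ys = ∂ₛY`. -/
structure Flow (q : ℝ → ℝ → ℝ) (x₀ : ℝ) (Y y Ys : ℝ → ℝ → ℝ) : Prop where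
  mem : x₀ ∈ Icc (0 : ℝ) 1
  td : HasTDeriv Y Ys
  ode : ∀ s, IsSol q fun ξ => Y ξ s
  base : ∀ s, Y x₀ s = s
  inv_right : ∀ x ∈ Icc (0 : ℝ) 1, ∀ t, Y x (y x t) = t
  inv_left : ∀ x ∈ Icc (0 : ℝ) 1, ∀ s, y x (Y x s) = s
  cts_inv : Cts y
  deriv_eq : ∀ x ∈ Icc (0 : ℝ) 1, ∀ s, Ys x s = Real.exp (∫ η in x₀..x, dT q η (Y η s))

lemma cts_of_abs_sub_le {F : ℝ → ℝ → ℝ} {A B : ℝ} (h : ∀ x ∈ Icc (0 : ℝ) 1, ∀ x' ∈ Icc (0 : ℝ) 1,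
    ∀ t t', |F x' t' - F x t| ≤ A * |x' - x| + B * |t' - t|) : Cts F := by
  intro p hp
  refine tendsto_iff_dist_tendsto_zero.2 ?_
  have hb : Tendsto (fun p' : ℝ × ℝ => A * |p'.1 - p.1| + B * |p'.2 - p.2|) (𝓝[strip] p) (𝓝 0) := by
    have : Continuous fun p' : ℝ × ℝ => A * |p'.1 - p.1| + B * |p'.2 - p.2| := by fun_prop
    have := this.tendsto p
    simp only [sub_self, abs_zero, mul_zero, add_zero] at this
    exact this.mono_left nhdsWithin_le_nhds
  refine squeeze_zero' (Eventually.of_forall fun _ => dist_nonneg) ?_ hb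
  filter_upwards [self_mem_nhdsWithin] with p' hp'
  exact h p.1 hp.1 p'.1 hp'.1 p.2 p'.2

lemma flow_vertical {x₀ : ℝ} (hx₀ : x₀ ∈ Icc (0 : ℝ) 1) :
    Flow (fun _ _ => 0) x₀ (fun _ s => s) (fun _ t => t) (fun _ _ => 1) where
  mem := hx₀
  td := HasTDeriv.time
  ode _ _ _ := hasDerivWithinAt_const _ _ _
  base _ := rfl
  inv_right _ _ _ := rfl
  inv_left _ _ _ := rfl
  cts_inv := HasTDeriv.time.cts
  deriv_eq x _ s := by simp [dT]

/-- A family of solutions through all points of the strip gives a flow. -/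
lemma flow_of_isSol {q : ℝ → ℝ → ℝ} (hq : CS 1 q) {M K : ℝ}
    (hM : ∀ x ∈ Icc (0 : ℝ) 1, ∀ t, |q x t| ≤ M) (hK : ∀ x ∈ Icc (0 : ℝ) 1, ∀ t, |dT q x t| ≤ K)
    {Φ : ℝ → ℝ → ℝ → ℝ} (hΦ : ∀ x ∈ Icc (0 : ℝ) 1, ∀ t, IsSol q fun ξ => Φ ξ x t)
    (hΦ0 : ∀ x ∈ Icc (0 : ℝ) 1, ∀ t, Φ x x t = t) {x₀ : ℝ} (hx₀ : x₀ ∈ Icc (0 : ℝ) 1) :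
    Flow q x₀ (fun ξ s => Φ ξ x₀ s) (fun x t => Φ x₀ x t)
      (fun x s => Real.exp (∫ η in x₀..x, dT q η (Φ η x₀ s))) := by
  have hY : Cts fun ξ s => Φ ξ x₀ s := by
    refine cts_of_abs_sub_le (A := M) (B := Real.exp K) fun x hx x' hx' t t' => ?_
    have h1 := (hΦ x₀ hx₀ t).abs_sub_le_mul hM hx hx'
    have h2 := (hΦ x₀ hx₀ t).abs_sub_le hq hK (hΦ x₀ hx₀ t') hx₀ hx'
    rw [hΦ0 x₀ hx₀, hΦ0 x₀ hx₀] at h2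
    calc _ ≤ |Φ x' x₀ t' - Φ x' x₀ t| + |Φ x' x₀ t - Φ x x₀ t| := abs_sub_le _ _ _
      _ ≤ _ := by linarith
  have hq' := hq.hasPartials.toHasTDeriv
  refine ⟨hx₀, ⟨hY, ((hq'.cts'.comp hY).integral hx₀).exp, fun x hx s => ?_⟩,
    fun s => hΦ x₀ hx₀ s, fun s => hΦ0 x₀ hx₀ s, fun x hx t => ?_, fun x hx s => ?_, ?_,
    fun _ _ _ => rfl⟩
  · have hc : Cts fun x s' => Real.exp (∫ η in x₀..x, segMean (dT q) η (Φ η x₀ s) (Φ η x₀ s')) :=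
      ((hq'.cts'.segMean (hY.comp (Cts.const s)) hY).integral hx₀).exp
    have h1 := hasDerivAt_mul_of_eq_zero (s := s) (hc.slice_left hx).continuousAt
    simp only [segMean_self] at h1
    refine (h1.add_const (Φ x x₀ s)).congr_of_eventuallyEq (Eventually.of_forall fun s' => ?_)
    have h2 := (hΦ x₀ hx₀ s).sub_eq hq (hΦ x₀ hx₀ s') hx₀ hx
    rw [hΦ0 x₀ hx₀, hΦ0 x₀ hx₀] at h2
    simp only
    linarith
  · rw [(hΦ x₀ hx₀ (Φ x₀ x t)).eq_of_eq hq (hΦ x hx t) hx₀ (hΦ0 x₀ hx₀ _) hx, hΦ0 x hx]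
  · have := (hΦ x hx (Φ x x₀ s)).eq_of_eq hq (hΦ x₀ hx₀ s) hx (hΦ0 x hx _) hx₀
    simpa only [hΦ0 x₀ hx₀] using this
  · refine cts_of_abs_sub_le (A := Real.exp K * M) (B := Real.exp K) fun x hx x' hx' t t' => ?_
    have h1 := (hΦ x hx t).abs_sub_le hq hK (hΦ x' hx' t') hx' hx₀
    have h2 := (hΦ x hx t).abs_sub_le_mul hM hx hx'
    rw [hΦ0 x' hx'] at h1
    rw [hΦ0 x hx] at h2
    have h3 : |t' - Φ x' x t| ≤ |t' - t| + M * |x' - x| := by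
      have := abs_sub_le t' t (Φ x' x t)
      rw [abs_sub_comm t] at this
      linarith
    calc _ ≤ Real.exp K * |t' - Φ x' x t| := h1
      _ ≤ Real.exp K * (|t' - t| + M * |x' - x|) := by gcongr
      _ = _ := by ring

namespace Flow

variable {q Y y Ys : ℝ → ℝ → ℝ} {x₀ : ℝ}

lemma deriv_pos (fl : Flow q x₀ Y y Ys) {x : ℝ} (hx : x ∈ Icc (0 : ℝ) 1) (s : ℝ) : 0 < Ys x s := by
  rw [fl.deriv_eq x hx s]; exact Real.exp_pos _

lemma inv_td (fl : Flow q x₀ Y y Ys) : HasTDeriv y fun x t => (Ys x (y x t))⁻¹ where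
  cts := fl.cts_inv
  cts' := (fl.td.cts'.comp fl.cts_inv).inv₀ fun _ hp => (fl.deriv_pos hp.1 _).ne'
  deriv x hx _ := HasDerivAt.of_local_left_inverse (fl.cts_inv.slice_left hx).continuousAt
    (fl.td.deriv x hx _) (fl.deriv_pos hx _).ne' (Eventually.of_forall fun t => fl.inv_right x hx t)

lemma hasPartials (fl : Flow q x₀ Y y Ys) (hq : Cts q) : HasPartials Y (fun x s => q x (Y x s)) Ys :=
  ⟨fl.td, hq.comp fl.td.cts, fun x hx s => fl.ode s x hx⟩

/-- A function given in the flow coordinates `(x,s)` by `G` has, in the coordinates `(x,t)`, the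
derivative `Gx(x,y(x,t))` along the flow. -/
lemma hasPartials_pull (fl : Flow q x₀ Y y Ys) (hq : Cts q) {G Gx Gs : ℝ → ℝ → ℝ}
    (hG : HasPartials G Gx Gs) : HasPartials (fun x t => G x (y x t))
      (fun x t => Gx x (y x t) - q x t * (Gs x (y x t) * (Ys x (y x t))⁻¹))
      (fun x t => Gs x (y x t) * (Ys x (y x t))⁻¹) :=
  hasPartials_of_flow (Y := Y) (y := y) (D := fun x t => Gx x (y x t))
    (hG.toHasTDeriv.comp fl.inv_td) (fun s => fl.ode s) fl.inv_right
    (fun s x hx => by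
      rw [fl.inv_left x hx s]
      exact (hG.derivx x hx s).congr (fun ξ hξ => by rw [fl.inv_left ξ hξ s])
        (by rw [fl.inv_left x hx s])) hq (hG.ctsx.comp fl.cts_inv)

lemma hasPartials_deriv (fl : Flow q x₀ Y y Ys) (hq : CS 2 q) :
    ∃ Yss, HasPartials Ys (fun x s => dT q x (Y x s) * Ys x s) Yss := by
  have h1 : CS 1 (dT q) := CS.dT (by simpa [one_add_one_eq_two] using hq)
  obtain ⟨Yss, hYss⟩ := ((h1.td.comp ⟨_, fl.td⟩).integral fl.mem).exp.congr fl.deriv_eq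
  refine ⟨Yss, hYss, (h1.cts.comp fl.td.cts).mul hYss.cts, fun x hx s => ?_⟩
  have h2 := ((hasDerivWithinAt_integral ((h1.cts.comp fl.td.cts).slice_right s)
    fl.mem hx).exp).congr (fun ξ hξ => fl.deriv_eq ξ hξ s) (fl.deriv_eq x hx s)
  rw [← fl.deriv_eq x hx s] at h2
  exact h2.congr_deriv (mul_comm _ _)

/-- **Averaging along transversal curves.** Let `v` be merely continuous, with a continuous
derivative `K` along the flow of `∂ₓ + q' ∂ₜ`. Then the integral of `v` along the curves of a
transversal flow is differentiable in the label of the curve: `v` is, up to a `C^1` factor, the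
`t`-derivative of the `C^1` function `M(x,t) = ∫₀^{y'(x,t)} v(x,Y'(x,σ)) dσ`, and by
transversality also a combination of two directional derivatives of `M`, of which the one along `q'`
is harmless and the one along `q` is handled by `HasPartials.integral_mul_deriv`. -/
lemma td_integral_transversal {q' Y' y' Ys' : ℝ → ℝ → ℝ} {x₁ : ℝ} (fl : Flow q x₀ Y y Ys)
    (fl' : Flow q' x₁ Y' y' Ys') (hq : CS 1 q) (hq' : CS 2 q')
    (hne : ∀ x ∈ Icc (0 : ℝ) 1, ∀ t, q x t ≠ q' x t) {v K : ℝ → ℝ → ℝ} (hv : Cts v) (hK : Cts K)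
    (hvK : ∀ s, ∀ x ∈ Icc (0 : ℝ) 1,
      HasDerivWithinAt (fun ξ => v ξ (Y' ξ s)) (K x (Y' x s)) (Icc 0 1) x)
    {c : ℝ → ℝ → ℝ} (hc : CS 1 c) {a : ℝ} (ha : a ∈ Icc (0 : ℝ) 1) :
    TD fun x s => ∫ ξ in a..x, c ξ (Y ξ s) * v ξ (Y ξ s) := by
  have hq'1 : CS 1 q' := hq'.mono (by norm_num)
  have hΘ := hasPartials_integral_time (hv.comp fl'.td.cts) (hK.comp fl'.td.cts)
    fun x hx s => hvK s x hx
  have hM := fl'.hasPartials_pull hq'1.cts hΘ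
  set N : ℝ → ℝ → ℝ := fun x t => ∫ σ in (0 : ℝ)..y' x t, K x (Y' x σ) with hN
  have hNtd : TD N :=
    TD.comp ⟨_, hasTDeriv_integral_time (hK.comp fl'.td.cts)⟩ ⟨_, fl'.inv_td⟩
  obtain ⟨Yss', hB0⟩ := fl'.hasPartials_deriv hq'
  have hB := fl'.hasPartials_pull hq'1.cts hB0
  have hb : CS 1 fun x t => c x t * Ys' x (y' x t) / (q x t - q' x t) :=
    (hc.mul hB.cs).div (hq.sub hq'1) fun x hx t => sub_ne_zero.2 (hne x hx t)
  have hY := fl.hasPartials hq.cts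
  have h1 := (hb.hasPartials.comp hY).integral_mul_deriv (hM.comp hY) ha
  have h2 := ((hb.td.comp ⟨_, fl.td⟩).mul (hNtd.comp ⟨_, fl.td⟩)).integral ha
  have hsub := TD.sub ⟨_, h1⟩ h2
  refine hsub.congr fun x hx s => ?_
  rw [← intervalIntegral.integral_sub]
  · refine intervalIntegral.integral_congr fun ξ hξ => ?_
    have hξ' := uIcc_subset_unit ha hx hξ
    have e1 := (fl'.deriv_pos hξ' (y' ξ (Y ξ s))).ne'
    have e2 := sub_ne_zero.2 (hne ξ hξ' (Y ξ s))
    simp only [hN, fl'.inv_right ξ hξ']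
    field_simp
    ring
  · exact ((hb.hasPartials.comp hY).cts.mul (hM.comp hY).ctsx).integrable ha hx s
  · exact ((hb.td.comp ⟨_, fl.td⟩).mul (hNtd.comp ⟨_, fl.td⟩)).cts.integrable ha hx s

end Flow

/-! ### Periodic functional equations -/

lemma exists_bound_of_periodic {T : ℝ} (hT : 0 < T) {F : ℝ → ℝ → ℝ} (hF : Cts F)
    (hper : ∀ x ∈ Icc (0 : ℝ) 1, ∀ t, F x (t + T) = F x t) :
    ∃ M, ∀ x ∈ Icc (0 : ℝ) 1, ∀ t, |F x t| ≤ M := by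
  obtain ⟨M, hM⟩ := ((isCompact_Icc (a := (0 : ℝ)) (b := 1)).prod
    (isCompact_Icc (a := (0 : ℝ)) (b := T))).exists_bound_of_continuousOn
    (hF.mono (prod_mono_right (subset_univ _)))
  refine ⟨M, fun x hx t => ?_⟩
  obtain ⟨s, hs, hst⟩ := Function.Periodic.exists_mem_Ico₀ (f := F x) (hper x hx) hT t
  rw [hst]
  exact hM (x, s) ⟨hx, hs.1, hs.2.le⟩

lemma exists_bound_of_periodic_real {T : ℝ} (hT : 0 < T) {f : ℝ → ℝ} (hf : Continuous f)
    (hper : ∀ t, f (t + T) = f t) : ∃ M, ∀ t, |f t| ≤ M := by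
  obtain ⟨M, hM⟩ := exists_bound_of_periodic hT (Cts.of_time hf) fun _ _ => hper
  exact ⟨M, hM 0 ⟨le_rfl, zero_le_one⟩⟩

lemma exists_lt_one_of_periodic {T : ℝ} (hT : 0 < T) {f : ℝ → ℝ} (hf : Continuous f)
    (hper : ∀ t, f (t + T) = f t) (h1 : ∀ t, f t < 1) : ∃ κ < 1, ∀ t, f t ≤ κ := by
  obtain ⟨s, _, hs⟩ := (isCompact_Icc (a := (0 : ℝ)) (b := T)).exists_isMaxOn
    (nonempty_Icc.2 hT.le) hf.continuousOn
  refine ⟨f s, h1 s, fun t => ?_⟩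
  obtain ⟨r, hr, hrt⟩ := Function.Periodic.exists_mem_Ico₀ (f := f) hper hT t
  rw [hrt]
  exact hs ⟨hr.1, hr.2.le⟩

lemma deriv_add_period {T c : ℝ} {f : ℝ → ℝ} (hper : ∀ t, f (t + T) = f t + c) (t : ℝ) :
    deriv f (t + T) = deriv f t := by
  have h : (fun t => f (t + T)) = fun t => f t + c := funext hper
  rw [← deriv_comp_add_const, h, deriv_add_const]

/-- A bounded solution of `p = L·(p ∘ φ) + G` is the sum of the series of iterates of `G` under
`g ↦ L·(g ∘ φ)`. It may be differentiated termwise when the operator is contracting both for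
functions (factor `L`) and for derivatives (factor `L φ'`). -/
lemma contDiff_of_contracting_loop {p L φ G : ℝ → ℝ} (hL : ContDiff ℝ 1 L) (hφ : ContDiff ℝ 1 φ)
    (hG : ContDiff ℝ 1 G) (heq : ∀ t, p t = L t * p (φ t) + G t) {Mp ML MG κ : ℝ}
    (hκ0 : 0 ≤ κ) (hκ : κ < 1) (hMp : ∀ t, |p t| ≤ Mp) (hML : ∀ t, |deriv L t| ≤ ML)
    (hMG : ∀ t, |G t| ≤ MG) (hMG' : ∀ t, |deriv G t| ≤ MG) (hLκ : ∀ t, |L t| ≤ κ)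
    (hLφ : ∀ t, |L t * deriv φ t| ≤ κ) : ContDiff ℝ 1 p := by
  let g : ℕ → ℝ → ℝ := fun n => n.rec G fun _ f t => L t * f (φ t)
  have g0 : g 0 = G := rfl
  have gs : ∀ n, g (n + 1) = fun t => L t * g n (φ t) := fun n => rfl
  have gC : ∀ n, ContDiff ℝ 1 (g n) := fun n => by
    induction n with
    | zero => exact hG
    | succ n ih => exact hL.mul (ih.comp hφ)
  have hMG0 : 0 ≤ MG := (abs_nonneg _).trans (hMG 0)
  have hML0 : 0 ≤ ML := (abs_nonneg _).trans (hML 0)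
  have gb : ∀ n t, |g n t| ≤ MG * κ ^ n := fun n => by
    induction n with
    | zero => simpa [g0] using hMG
    | succ n ih =>
      intro t
      rw [gs, abs_mul]
      calc _ ≤ κ * (MG * κ ^ n) := mul_le_mul (hLκ t) (ih _) (abs_nonneg _) hκ0
        _ = _ := by ring
  -- a rate strictly between `κ` and `1` absorbs the terms with the derivative of `L`
  obtain ⟨r, hr1, hr2⟩ := exists_between hκ
  have hr0 : 0 < r := hκ0.trans_lt hr1
  set B := MG + ML * MG / (r - κ) with hB
  have hrk : 0 < r - κ := sub_pos.2 hr1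
  have hBB : ML * MG ≤ B * (r - κ) := by
    rw [hB, add_mul, div_mul_cancel₀ _ hrk.ne']
    nlinarith [mul_nonneg hMG0 hrk.le]
  have hB0 : 0 ≤ B := by positivity
  have gd : ∀ n t, HasDerivAt (g n) (deriv (g n) t) t := fun n t =>
    ((gC n).differentiable one_ne_zero t).hasDerivAt
  have hLd : ∀ t, HasDerivAt L (deriv L t) t := fun t =>
    (hL.differentiable one_ne_zero t).hasDerivAt
  have hφd : ∀ t, HasDerivAt φ (deriv φ t) t := fun t =>
    (hφ.differentiable one_ne_zero t).hasDerivAt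
  have gb' : ∀ n t, |deriv (g n) t| ≤ B * r ^ n := fun n => by
    induction n with
    | zero =>
      intro t
      rw [g0, pow_zero, mul_one]
      exact (hMG' t).trans (le_add_of_nonneg_right (by positivity))
    | succ n ih =>
      intro t
      have hd : HasDerivAt (g (n + 1))
          (deriv L t * g n (φ t) + L t * (deriv (g n) (φ t) * deriv φ t)) t :=
        (hLd t).mul ((gd n (φ t)).comp t (hφd t))
      rw [hd.deriv]
      have e1 : |deriv L t * g n (φ t)| ≤ ML * (MG * r ^ n) := by
        rw [abs_mul]
        refine mul_le_mul (hML t) ((gb n _).trans ?_) (abs_nonneg _) hML0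
        gcongr
      have e2 : |L t * (deriv (g n) (φ t) * deriv φ t)| ≤ κ * (B * r ^ n) := by
        rw [mul_comm (deriv (g n) (φ t)), ← mul_assoc, abs_mul]
        exact mul_le_mul (hLφ t) (ih _) (abs_nonneg _) hκ0
      have hrn : 0 ≤ r ^ n := by positivity
      calc _ ≤ ML * (MG * r ^ n) + κ * (B * r ^ n) := (abs_add_le _ _).trans (add_le_add e1 e2)
        _ = (ML * MG + κ * B) * r ^ n := by ring
        _ ≤ (B * r) * r ^ n := by gcongr; linarith
        _ = _ := by ring
  have hrem : ∀ n t, |p t - ∑ i ∈ Finset.range n, g i t| ≤ Mp * κ ^ n := fun n => by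
    induction n with
    | zero => simpa using hMp
    | succ n ih =>
      intro t
      have e : p t - ∑ i ∈ Finset.range (n + 1), g i t =
          L t * (p (φ t) - ∑ i ∈ Finset.range n, g i (φ t)) := by
        rw [Finset.sum_range_succ', heq t, mul_sub, Finset.mul_sum, g0]
        simp only [gs]
        ring
      rw [e, abs_mul]
      calc _ ≤ κ * (Mp * κ ^ n) := mul_le_mul (hLκ t) (ih _) (abs_nonneg _) hκ0
        _ = _ := by ring
  have hsum : ∀ t, Summable fun n => g n t := fun t =>
    Summable.of_norm_bounded ((summable_geometric_of_lt_one hκ0 hκ).mul_left MG) fun n => gb n t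
  have hp : p = fun t => ∑' n, g n t := funext fun t => by
    refine tendsto_nhds_unique ?_ (hsum t).hasSum.tendsto_sum_nat
    have h0 : Tendsto (fun n => Mp * κ ^ n) atTop (𝓝 0) := by
      simpa using (tendsto_pow_atTop_nhds_zero_of_lt_one hκ0 hκ).const_mul Mp
    rw [tendsto_iff_dist_tendsto_zero]
    refine squeeze_zero (fun _ => dist_nonneg) (fun n => ?_) h0
    rw [dist_comm]
    exact hrem n t
  have hu : Summable fun n => B * r ^ n := (summable_geometric_of_lt_one hr0.le hr2).mul_left B
  have hd := hasDerivAt_tsum hu gd gb' (hsum 0)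
  rw [hp, contDiff_one_iff_deriv]
  refine ⟨fun t => (hd t).differentiableAt, ?_⟩
  rw [funext fun t => (hd t).deriv]
  exact continuous_tsum (fun n => (gC n).continuous_deriv le_rfl) hu gb'

/-- A continuous periodic solution of `p = L·(p ∘ φ) + G` is `C^1` if `L` and `L φ'` are both below
`1` or both above `1`; in the second case the equation is solved for `p ∘ φ`. -/
lemma contDiff_of_loop {T : ℝ} (hT : 0 < T) {p L φ ψ G : ℝ → ℝ} (hp : Continuous p)
    (hpT : ∀ t, p (t + T) = p t) (hL : ContDiff ℝ 1 L) (hLT : ∀ t, L (t + T) = L t)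
    (hL0 : ∀ t, 0 < L t) (hφ : ContDiff ℝ 1 φ) (hφT : ∀ t, φ (t + T) = φ t + T)
    (hψ : ContDiff ℝ 1 ψ) (hψT : ∀ t, ψ (t + T) = ψ t + T) (hφψ : ∀ t, φ (ψ t) = t)
    (hφ' : ∀ t, 0 < deriv φ t) (hG : ContDiff ℝ 1 G) (heq : ∀ t, p t = L t * p (φ t) + G t)
    (h : (∀ t, L t < 1 ∧ L t * deriv φ t < 1) ∨ ∀ t, 1 < L t ∧ 1 < L t * deriv φ t) :
    ContDiff ℝ 1 p := by
  obtain ⟨Mp, hMp⟩ := exists_bound_of_periodic_real hT hp hpT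
  have contracting : ∀ {L φ G : ℝ → ℝ}, ContDiff ℝ 1 L → (∀ t, L (t + T) = L t) → (∀ t, 0 < L t) →
      ContDiff ℝ 1 φ → (∀ t, φ (t + T) = φ t + T) → (∀ t, 0 < deriv φ t) → ContDiff ℝ 1 G →
      (∀ t, p t = L t * p (φ t) + G t) → (∀ t, L t < 1 ∧ L t * deriv φ t < 1) →
      ContDiff ℝ 1 p := by
    intro L φ G hL hLT hL0 hφ hφT hφ' hG heq h
    have hGT : ∀ t, G (t + T) = G t := fun t => by
      have e1 := heq t
      have e2 := heq (t + T)
      rw [hpT, hLT, hφT, hpT] at e2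
      linarith
    have hc : ∀ {f : ℝ → ℝ}, ContDiff ℝ 1 f → Continuous (deriv f) := fun hf =>
      hf.continuous_deriv le_rfl
    obtain ⟨ML, hML⟩ := exists_bound_of_periodic_real hT (hc hL)
      (deriv_add_period (c := 0) (by simpa using hLT))
    obtain ⟨M1, hM1⟩ := exists_bound_of_periodic_real hT hG.continuous hGT
    obtain ⟨M2, hM2⟩ := exists_bound_of_periodic_real hT (hc hG)
      (deriv_add_period (c := 0) (by simpa using hGT))
    obtain ⟨κ1, h1, hκ1⟩ := exists_lt_one_of_periodic hT hL.continuous hLT fun t => (h t).1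
    obtain ⟨κ2, h2, hκ2⟩ := exists_lt_one_of_periodic hT (hL.continuous.mul (hc hφ))
      (fun t => by simp only [Pi.mul_apply, hLT, deriv_add_period hφT]) fun t => (h t).2
    refine contDiff_of_contracting_loop (κ := max κ1 κ2) (MG := max M1 M2) hL hφ hG heq
      ((hL0 0).le.trans ((hκ1 0).trans (le_max_left _ _))) (max_lt h1 h2) hMp hML
      (fun t => (hM1 t).trans (le_max_left _ _)) (fun t => (hM2 t).trans (le_max_right _ _))
      (fun t => ?_) fun t => ?_
    · rw [abs_of_pos (hL0 t)]
      exact (hκ1 t).trans (le_max_left _ _)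
    · rw [abs_of_pos (mul_pos (hL0 t) (hφ' t))]
      exact (hκ2 t).trans (le_max_right _ _)
  rcases h with h | h
  · exact contracting hL hLT hL0 hφ hφT hφ' hG heq h
  · have hψ' : ∀ t, deriv φ (ψ t) * deriv ψ t = 1 := fun t => by
      have h1 := ((hφ.differentiable one_ne_zero (ψ t)).hasDerivAt.comp t
        (hψ.differentiable one_ne_zero t).hasDerivAt).deriv
      rw [show φ ∘ ψ = id from funext hφψ, deriv_id] at h1
      exact h1.symm
    refine contracting (L := fun t => (L (ψ t))⁻¹) (φ := ψ) (G := fun t => -(G (ψ t) * (L (ψ t))⁻¹))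
      ((hL.comp hψ).inv fun t => (hL0 _).ne') (fun t => by simp only [hψT, hLT])
      (fun t => inv_pos.2 (hL0 _)) hψ hψT (fun t => ?_)
      ((hG.comp hψ).mul ((hL.comp hψ).inv fun t => (hL0 _).ne')).neg (fun t => ?_)
      fun t => ⟨inv_lt_one_of_one_lt₀ (h _).1, ?_⟩
    · exact pos_of_mul_pos_right (by rw [hψ' t]; exact one_pos) (hφ' (ψ t)).le
    · have e := heq (ψ t)
      rw [hφψ] at e
      have := (hL0 (ψ t)).ne'
      rw [e]
      field_simp
      ring
    · have e1 : deriv ψ t = (deriv φ (ψ t))⁻¹ := eq_inv_of_mul_eq_one_right (hψ' t)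
      rw [e1, ← mul_inv]
      exact inv_lt_one_of_one_lt₀ (h _).2

/-- The boundary values `A`, `B` of the two transported quantities determine each other through the
two families of characteristics. Going once around the loop gives an equation for `A` alone. -/
lemma contDiff_of_coupled {T : ℝ} (hT : 0 < T) {A B e₁ e₂ y₁ y₂ z₁ z₂ G₁ G₂ : ℝ → ℝ}
    (hA : Continuous A) (hAT : ∀ t, A (t + T) = A t)
    (he₁ : ContDiff ℝ 1 e₁) (he₂ : ContDiff ℝ 1 e₂) (he₁T : ∀ t, e₁ (t + T) = e₁ t)
    (he₂T : ∀ t, e₂ (t + T) = e₂ t) (he₁0 : ∀ t, 0 < e₁ t) (he₂0 : ∀ t, 0 < e₂ t)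
    (hy₁ : ContDiff ℝ 1 y₁) (hy₂ : ContDiff ℝ 1 y₂) (hz₁ : ContDiff ℝ 1 z₁) (hz₂ : ContDiff ℝ 1 z₂)
    (hy₁T : ∀ t, y₁ (t + T) = y₁ t + T) (hy₂T : ∀ t, y₂ (t + T) = y₂ t + T)
    (hz₁T : ∀ t, z₁ (t + T) = z₁ t + T) (hz₂T : ∀ t, z₂ (t + T) = z₂ t + T)
    (hyz₁ : ∀ t, y₁ (z₁ t) = t) (hyz₂ : ∀ t, y₂ (z₂ t) = t)
    (hy₁0 : ∀ t, 0 < deriv y₁ t) (hy₂0 : ∀ t, 0 < deriv y₂ t)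
    (hG₁ : ContDiff ℝ 1 G₁) (hG₂ : ContDiff ℝ 1 G₂)
    (h₁ : ∀ t, A t = e₁ t * B (y₁ t) + G₁ t) (h₂ : ∀ t, B t = e₂ t * A (y₂ t) + G₂ t)
    (h : (∀ t, e₁ t * e₂ (y₁ t) < 1 ∧
        (e₁ t * deriv y₁ t) * (e₂ (y₁ t) * deriv y₂ (y₁ t)) < 1) ∨
      ∀ t, 1 < e₁ t * e₂ (y₁ t) ∧ 1 < (e₁ t * deriv y₁ t) * (e₂ (y₁ t) * deriv y₂ (y₁ t))) :
    ContDiff ℝ 1 A ∧ ContDiff ℝ 1 B := by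
  have hd : ∀ t, deriv (fun t => y₂ (y₁ t)) t = deriv y₂ (y₁ t) * deriv y₁ t := fun t =>
    ((hy₂.differentiable one_ne_zero (y₁ t)).hasDerivAt.comp t
      (hy₁.differentiable one_ne_zero t).hasDerivAt).deriv
  have e : ∀ t, e₁ t * e₂ (y₁ t) * (deriv y₂ (y₁ t) * deriv y₁ t) =
    (e₁ t * deriv y₁ t) * (e₂ (y₁ t) * deriv y₂ (y₁ t)) := fun t => by ring
  have hAC : ContDiff ℝ 1 A :=
    contDiff_of_loop hT (L := fun t => e₁ t * e₂ (y₁ t)) (φ := fun t => y₂ (y₁ t))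
      (ψ := fun t => z₁ (z₂ t)) (G := fun t => e₁ t * G₂ (y₁ t) + G₁ t) hA hAT
      (he₁.mul (he₂.comp hy₁)) (fun t => by simp only [he₁T, hy₁T, he₂T])
      (fun t => mul_pos (he₁0 _) (he₂0 _)) (hy₂.comp hy₁) (fun t => by simp only [hy₁T, hy₂T])
      (hz₁.comp hz₂) (fun t => by simp only [hz₂T, hz₁T]) (fun t => by simp only [hyz₁, hyz₂])
      (fun t => by rw [hd]; exact mul_pos (hy₂0 _) (hy₁0 _)) ((he₁.mul (hG₂.comp hy₁)).add hG₁)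
      (fun t => by rw [h₁ t, h₂ (y₁ t)]; ring) (by simpa only [hd, e] using h)
  refine ⟨hAC, ?_⟩
  rw [show B = fun t => e₂ t * A (y₂ t) + G₂ t from funext h₂]
  exact (he₂.mul (hAC.comp hy₂)).add hG₂

lemma HasTDeriv.contDiff_slice {F Ft : ℝ → ℝ → ℝ} (h : HasTDeriv F Ft) {x : ℝ}
    (hx : x ∈ Icc (0 : ℝ) 1) : ContDiff ℝ 1 (F x) := by
  rw [contDiff_one_iff_deriv]
  refine ⟨fun t => (h.deriv x hx t).differentiableAt, ?_⟩
  rw [funext fun t => (h.deriv x hx t).deriv]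
  exact h.cts'.slice_left hx

lemma TD.contDiff_slice {F : ℝ → ℝ → ℝ} (h : TD F) {x : ℝ} (hx : x ∈ Icc (0 : ℝ) 1) :
    ContDiff ℝ 1 (F x) := h.choose_spec.contDiff_slice hx

/-! ### Transport along one family of characteristics -/

/-- `v` satisfies `∂ₓv + q ∂ₜv = -q (β v + b v' - g)` along the curves `Y`. -/
def Transport (q Y β b g v v' : ℝ → ℝ → ℝ) : Prop :=
  ∀ s, ∀ x ∈ Icc (0 : ℝ) 1, HasDerivWithinAt (fun ξ => v ξ (Y ξ s))
    (-q x (Y x s) * (β x (Y x s) * v x (Y x s) + b x (Y x s) * v' x (Y x s) - g x (Y x s)))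
    (Icc 0 1) x

/-- The factor by which the homogeneous equation `∂ₓv + q ∂ₜv = -q β v` multiplies `v` on the way
from `x₀` to `(x,t)`. -/
noncomputable def amp (q Y y β : ℝ → ℝ → ℝ) (x₀ x t : ℝ) : ℝ :=
  Real.exp (∫ η in x₀..x, -q η (Y η (y x t)) * β η (Y η (y x t)))

section

variable {q Y y Ys q' Y' y' Ys' β b g v v' : ℝ → ℝ → ℝ} {x₀ x₁ : ℝ}

lemma Flow.td_amp (fl : Flow q x₀ Y y Ys) (hq : CS 1 q) (hβ : CS 1 β) :
    TD (amp q Y y β x₀) := by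
  have hY : TD Y := ⟨_, fl.td⟩
  have h := (((hq.td.comp hY).neg.mul (hβ.td.comp hY)).integral fl.mem).exp
  exact h.comp ⟨_, fl.inv_td⟩

/-- Solving the transport equation: `v` is its initial value transported along the characteristics,
up to a term that has a `t`-derivative, although `v'` is merely continuous. -/
lemma Flow.eq_amp_mul_add (fl : Flow q x₀ Y y Ys) (fl' : Flow q' x₁ Y' y' Ys') (hq : CS 1 q)
    (hq' : CS 2 q') (hne : ∀ x ∈ Icc (0 : ℝ) 1, ∀ t, q x t ≠ q' x t) (hβ : CS 1 β) (hb : CS 1 b)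
    (hg : TD g) (hv' : Cts v') {K : ℝ → ℝ → ℝ} (hK : Cts K)
    (hvK : ∀ s, ∀ x ∈ Icc (0 : ℝ) 1,
      HasDerivWithinAt (fun ξ => v' ξ (Y' ξ s)) (K x (Y' x s)) (Icc 0 1) x)
    (htr : Transport q Y β b g v v') :
    ∃ Z, TD Z ∧ ∀ x ∈ Icc (0 : ℝ) 1, ∀ t,
      v x t = amp q Y y β x₀ x t * v x₀ (y x t) + Z x t := by
  have hY : TD Y := ⟨_, fl.td⟩
  set e : ℝ → ℝ → ℝ := fun x s => Real.exp (-∫ η in x₀..x, -q η (Y η s) * β η (Y η s)) with he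
  have hA : TD fun x s => -q x (Y x s) * β x (Y x s) := (hq.td.comp hY).neg.mul (hβ.td.comp hY)
  have heP : ∃ es, HasPartials e
      (fun x s => e x s * -(-q x (Y x s) * β x (Y x s))) es := by
    obtain ⟨es, hes⟩ := (hA.integral fl.mem).neg.exp
    exact ⟨es, hes, hes.cts.mul hA.cts.neg, fun x hx s =>
      (hasDerivWithinAt_integral (hA.cts.slice_right s) fl.mem hx).neg.exp⟩
  obtain ⟨es, heP⟩ := heP
  have hec : CS 1 fun x t => e x (y x t) * (-q x t * b x t) :=
    (fl.hasPartials_pull hq.cts heP).cs.mul (hq.neg.mul hb)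
  have h1 := fl.td_integral_transversal fl' hq hq' hne hv' hK hvK hec fl.mem
  have h2 := (TD.mul ⟨_, heP.toHasTDeriv⟩ ((hq.td.comp hY).mul (hg.comp hY))).integral fl.mem
  have h3 := (fl.td_amp hq hβ).mul ((h1.add h2).comp ⟨_, fl.inv_td⟩)
  refine ⟨_, h3, fun x hx t => ?_⟩
  have hB : Cts fun x s => -q x (Y x s) * (b x (Y x s) * v' x (Y x s) - g x (Y x s)) :=
    (hq.cts.comp hY.cts).neg.mul (((hb.cts.comp hY.cts).mul (hv'.comp hY.cts)).sub
      (hg.cts.comp hY.cts))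
  have hode := linear_ode_eq (f := fun ξ => v ξ (Y ξ (y x t))) (hA.cts.slice_right (y x t))
    (hB.slice_right (y x t)) (fun ξ hξ => (htr (y x t) ξ hξ).congr_deriv (by ring)) fl.mem hx
  simp only [fl.inv_right x hx t, fl.base] at hode
  rw [hode, mul_add]
  simp only [amp]
  congr 2
  rw [← intervalIntegral.integral_add]
  · refine intervalIntegral.integral_congr fun ξ hξ => ?_
    simp only [fl.inv_left ξ (uIcc_subset_unit fl.mem hx hξ), he]
    ring
  · exact (hec.cts.comp hY.cts |>.mul (hv'.comp hY.cts)).integrable fl.mem hx _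
  · exact (heP.cts.mul ((hq.cts.comp hY.cts).mul (hg.cts.comp hY.cts))).integrable fl.mem hx _

lemma Transport.cts (hq : Cts q) (hβ : Cts β) (hb : Cts b) (hg : Cts g) (hv : Cts v)
    (hv' : Cts v') : Cts fun x t => -q x t * (β x t * v x t + b x t * v' x t - g x t) :=
  hq.neg.mul (((hβ.mul hv).add (hb.mul hv')).sub hg)

/-- A solution of the transport equation whose initial value is `C^1` is itself `C^1`. -/
lemma Flow.hasPartials_of_transport (fl : Flow q x₀ Y y Ys) (fl' : Flow q' x₁ Y' y' Ys')
    (hq : CS 1 q) (hq' : CS 2 q') (hne : ∀ x ∈ Icc (0 : ℝ) 1, ∀ t, q x t ≠ q' x t) (hβ : CS 1 β)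
    (hb : CS 1 b) (hg : TD g) (hv : Cts v) (hv' : Cts v') {K : ℝ → ℝ → ℝ} (hK : Cts K)
    (hvK : ∀ s, ∀ x ∈ Icc (0 : ℝ) 1,
      HasDerivWithinAt (fun ξ => v' ξ (Y' ξ s)) (K x (Y' x s)) (Icc 0 1) x)
    (htr : Transport q Y β b g v v') (h0 : ContDiff ℝ 1 (v x₀)) :
    HasPartials v (fun x t => -q x t * (β x t * v x t + b x t * v' x t - g x t) -
      q x t * dT v x t) (dT v) := by
  obtain ⟨Z, hZ, hvZ⟩ := fl.eq_amp_mul_add fl' hq hq' hne hβ hb hg hv' hK hvK htr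
  have htd : TD v := (((fl.td_amp hq hβ).mul
    ((CS.of_time h0).td.comp ⟨_, fl.inv_td⟩)).add hZ).congr hvZ
  exact hasPartials_of_flow htd.hasTDeriv (fun s => fl.ode s) fl.inv_right
    (fun s x hx => htr s x hx) hq.cts (Transport.cts hq.cts hβ.cts hb.cts hg.cts hv hv')

/-- The `t`-derivative of a solution of the transport equation solves a transport equation with `β`
replaced by `β + ∂ₜq/q`. -/
lemma Flow.transport_dT (fl : Flow q x₀ Y y Ys) (hq : CS 2 q) (hq0 : ∀ x ∈ Icc (0 : ℝ) 1, ∀ t,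
    q x t ≠ 0) (hβ : TD β) (hb : TD b) (hg : TD g) (hv : TD v) (hv' : TD v')
    (htr : Transport q Y β b g v v') :
    Transport q Y (fun x t => β x t + dT q x t / q x t) b
      (fun x t => dT g x t - dT β x t * v x t - dT b x t * v' x t -
        dT q x t / q x t * (β x t * v x t + b x t * v' x t - g x t)) (dT v) (dT v') := by
  have hq1 : CS 1 q := hq.mono (by norm_num)
  have hKt := hq1.td.hasTDeriv.neg.mul
    (((hβ.hasTDeriv.mul hv.hasTDeriv).add (hb.hasTDeriv.mul hv'.hasTDeriv)).sub hg.hasTDeriv)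
  have hKY := hKt.comp fl.td
  have hvY := hv.hasTDeriv.comp fl.td
  obtain ⟨Yss, hYs⟩ := fl.hasPartials_deriv hq
  intro s x hx
  -- the mixed derivative of `v(ξ,Y(ξ,s))`, obtained from the integrated equation
  have e : ∀ ξ ∈ Icc (0 : ℝ) 1, dT v ξ (Y ξ s) * Ys ξ s =
      dT v x₀ (Y x₀ s) * Ys x₀ s + ∫ η in x₀..ξ, _ := fun ξ hξ => by
    have h2 := (hvY.deriv x₀ fl.mem s).add ((hKY.integral fl.mem).deriv ξ hξ s)
    refine (hvY.deriv ξ hξ s).unique (h2.congr_of_eventuallyEq (Eventually.of_forall fun s' => ?_))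
    have := integral_eq_sub_of_unit (hKY.cts.slice_right s') (fun η hη => htr s' η hη) fl.mem hξ
    simp only [Pi.add_apply]
    linarith
  have d1 := ((hasDerivWithinAt_integral (hKY.cts'.slice_right s) fl.mem hx).const_add
    (dT v x₀ (Y x₀ s) * Ys x₀ s)).congr e (e x hx)
  have hpos := fun ξ hξ => (fl.deriv_pos (x := ξ) hξ s).ne'
  have d2 := (d1.div (hYs.derivx x hx s) (hpos x hx)).congr
    (f₁ := fun ξ => dT v ξ (Y ξ s)) (fun ξ hξ => (mul_div_cancel_right₀ _ (hpos ξ hξ)).symm)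
    (mul_div_cancel_right₀ _ (hpos x hx)).symm
  refine d2.congr_deriv ?_
  have := hpos x hx
  have := hq0 x hx (Y x s)
  field_simp
  ring

end

/-! ### The characteristics of the wave operator -/

lemma zero_mem_unit : (0 : ℝ) ∈ Icc (0 : ℝ) 1 := ⟨le_rfl, zero_le_one⟩

lemma one_mem_unit : (1 : ℝ) ∈ Icc (0 : ℝ) 1 := ⟨zero_le_one, le_rfl⟩

lemma dX_add_period {T : ℝ} {F : ℝ → ℝ → ℝ}
    (h : ∀ x ∈ Icc (0 : ℝ) 1, ∀ t, F x (t + T) = F x t) :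
    ∀ x ∈ Icc (0 : ℝ) 1, ∀ t, dX F x (t + T) = dX F x t := fun x hx t =>
  derivWithin_congr (fun y hy => h y hy t) (h x hx t)

lemma dT_add_period {T : ℝ} {F : ℝ → ℝ → ℝ}
    (h : ∀ x ∈ Icc (0 : ℝ) 1, ∀ t, F x (t + T) = F x t) :
    ∀ x ∈ Icc (0 : ℝ) 1, ∀ t, dT F x (t + T) = dT F x t := fun x hx t =>
  deriv_add_period (c := 0) (by simpa using h x hx) t

namespace Data

variable (P : Data)

/-- The standing assumptions under which the characteristics are well defined and their
`t`-derivatives are `C^1`. -/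
structure Regular : Prop where
  T_pos : 0 < P.T
  a_pos : ∀ x ∈ Icc (0 : ℝ) 1, ∀ t : ℝ, 0 < P.a x t
  a_cs : CS 2 P.a
  a_per : ∀ x ∈ Icc (0 : ℝ) 1, ∀ t : ℝ, P.a x (t + P.T) = P.a x t

/-- The slope `dt/dx = (-1)^j / a` of the characteristics of the family `j`. -/
noncomputable def slope (j : ℕ) (x t : ℝ) : ℝ := (-1 : ℝ) ^ j / P.a x t

/-- The diagonal coefficient `b_{jj} - l ∂ₜa / a` of the system that is satisfied by `∂ₜ^l u`. -/
noncomputable def diag (l j : ℕ) (x t : ℝ) : ℝ := P.bdiag j x t - l * (P.at' x t / P.a x t)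

namespace Regular

variable {P} {j : ℕ}

lemma slope_cs (hP : P.Regular) {n : WithTop ℕ∞} (j : ℕ) (ha : CS n P.a) : CS n (P.slope j) :=
  (CS.const _).div ha fun x hx t => (hP.a_pos x hx t).ne'

lemma slope_cs_two (hP : P.Regular) (j : ℕ) : CS 2 (P.slope j) := hP.slope_cs j hP.a_cs

lemma slope_cs_one (hP : P.Regular) (j : ℕ) : CS 1 (P.slope j) :=
  (hP.slope_cs_two j).mono (by norm_num)

lemma slope_per (hP : P.Regular) (j : ℕ) :
    ∀ x ∈ Icc (0 : ℝ) 1, ∀ t, P.slope j x (t + P.T) = P.slope j x t := fun x hx t => by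
  simp only [slope, hP.a_per x hx t]

lemma slope_ne_zero (hP : P.Regular) (j : ℕ) :
    ∀ x ∈ Icc (0 : ℝ) 1, ∀ t, P.slope j x t ≠ 0 := fun x hx t =>
  div_ne_zero (pow_ne_zero _ (by norm_num)) (hP.a_pos x hx t).ne'

lemma slope_one_ne_two (hP : P.Regular) :
    ∀ x ∈ Icc (0 : ℝ) 1, ∀ t, P.slope 1 x t ≠ P.slope 2 x t := fun x hx t => by
  have := hP.a_pos x hx t
  have h1 : P.slope 1 x t < 0 := by
    simp only [slope, pow_one]
    exact div_neg_of_neg_of_pos (by norm_num) this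
  have h2 : 0 < P.slope 2 x t := by
    simp only [slope]
    positivity
  exact (h1.trans h2).ne

lemma dT_slope (hP : P.Regular) {x : ℝ} (hx : x ∈ Icc (0 : ℝ) 1) (t : ℝ) :
    dT (P.slope j) x t / P.slope j x t = -(P.at' x t / P.a x t) := by
  have h0 := (hP.a_pos x hx t).ne'
  have ha : HasDerivAt (fun s => P.a x s) (P.at' x t) t :=
    (hP.a_cs.mono (by norm_num) : CS 1 P.a).hasPartials.deriv x hx t
  have h1 : dT (P.slope j) x t = -((-1 : ℝ) ^ j * P.at' x t) / P.a x t ^ 2 := by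
    have := ((hasDerivAt_const t ((-1 : ℝ) ^ j)).div ha h0).deriv
    rw [zero_mul, zero_sub] at this
    exact this
  rw [h1, slope]
  have : (-1 : ℝ) ^ j ≠ 0 := pow_ne_zero _ (by norm_num)
  field_simp

lemma exists_bounds (hP : P.Regular) (j : ℕ) :
    ∃ M K, (∀ x ∈ Icc (0 : ℝ) 1, ∀ t, |P.slope j x t| ≤ M) ∧
      ∀ x ∈ Icc (0 : ℝ) 1, ∀ t, |dT (P.slope j) x t| ≤ K := by
  obtain ⟨M, hM⟩ := exists_bound_of_periodic hP.T_pos (hP.slope_cs_two j).cts (hP.slope_per j)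
  obtain ⟨K, hK⟩ := exists_bound_of_periodic hP.T_pos (hP.slope_cs_one j).hasPartials.cts'
    (dT_add_period (hP.slope_per j))
  exact ⟨M, K, hM, hK⟩

lemma isCharacteristic_τ (hP : P.Regular) (j : ℕ) {x : ℝ} (hx : x ∈ Icc (0 : ℝ) 1) (t : ℝ) :
    IsCharacteristic P.a j x t fun ξ => P.τ j ξ x t := by
  obtain ⟨M, K, hM, hK⟩ := hP.exists_bounds j
  obtain ⟨y, hy0, hy⟩ := exists_isSol (hP.slope_cs_one j) hM hK hx t
  have h : ∃ y : ℝ → ℝ, IsCharacteristic P.a j x t y := ⟨y, hy, hy0⟩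
  have e : (fun ξ => P.τ j ξ x t) = h.choose := funext fun ξ => by rw [Data.τ, dif_pos h]
  rw [e]
  exact h.choose_spec

lemma isSol_τ (hP : P.Regular) (j : ℕ) {x : ℝ} (hx : x ∈ Icc (0 : ℝ) 1) (t : ℝ) :
    IsSol (P.slope j) fun ξ => P.τ j ξ x t := (hP.isCharacteristic_τ j hx t).1

lemma τ_self (hP : P.Regular) (j : ℕ) {x : ℝ} (hx : x ∈ Icc (0 : ℝ) 1) (t : ℝ) :
    P.τ j x x t = t := (hP.isCharacteristic_τ j hx t).2

lemma τ_τ (hP : P.Regular) (j : ℕ) {x₀ x ξ : ℝ} (hx₀ : x₀ ∈ Icc (0 : ℝ) 1)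
    (hx : x ∈ Icc (0 : ℝ) 1) (hξ : ξ ∈ Icc (0 : ℝ) 1) (t : ℝ) :
    P.τ j ξ x₀ (P.τ j x₀ x t) = P.τ j ξ x t :=
  (hP.isSol_τ j hx₀ _).eq_of_eq (hP.slope_cs_one j) (hP.isSol_τ j hx t) hx₀
    (hP.τ_self j hx₀ _) hξ

lemma τ_add_period (hP : P.Regular) (j : ℕ) {x ξ : ℝ} (hx : x ∈ Icc (0 : ℝ) 1)
    (hξ : ξ ∈ Icc (0 : ℝ) 1) (t : ℝ) : P.τ j ξ x (t + P.T) = P.τ j ξ x t + P.T := by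
  have h : IsSol (P.slope j) fun ξ => P.τ j ξ x t + P.T := fun η hη => by
    rw [hP.slope_per j η hη]
    exact (hP.isSol_τ j hx t η hη).add_const _
  exact (hP.isSol_τ j hx _).eq_of_eq (hP.slope_cs_one j) h hx
    (by rw [hP.τ_self j hx, hP.τ_self j hx]) hξ

lemma flow (hP : P.Regular) (j : ℕ) {x₀ : ℝ} (hx₀ : x₀ ∈ Icc (0 : ℝ) 1) :
    Flow (P.slope j) x₀ (fun ξ s => P.τ j ξ x₀ s) (fun x t => P.τ j x₀ x t)
      (fun x s => Real.exp (∫ η in x₀..x, dT (P.slope j) η (P.τ j η x₀ s))) := by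
  obtain ⟨M, K, hM, hK⟩ := hP.exists_bounds j
  exact flow_of_isSol (hP.slope_cs_one j) hM hK (Φ := fun ξ x t => P.τ j ξ x t)
    (fun x hx t => hP.isSol_τ j hx t) (fun x hx t => hP.τ_self j hx t) hx₀

lemma cl_eq_amp (hP : P.Regular) (l j : ℕ) {x₀ x : ℝ} (hx₀ : x₀ ∈ Icc (0 : ℝ) 1)
    (hx : x ∈ Icc (0 : ℝ) 1) (t : ℝ) :
    P.cl l j x₀ x t = amp (P.slope j) (fun ξ s => P.τ j ξ x₀ s) (fun x t => P.τ j x₀ x t)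
      (P.diag l j) x₀ x t := by
  rw [Data.cl, amp, intervalIntegral.integral_symm, ← intervalIntegral.integral_neg]
  congr 1
  refine intervalIntegral.integral_congr fun η hη => ?_
  have hη' := uIcc_subset_unit hx₀ hx hη
  have := (hP.a_pos η hη' (P.τ j η x t)).ne'
  simp only [hP.τ_τ j hx₀ hx hη', slope, diag]
  field_simp

lemma cl_pos (l j : ℕ) (ξ x t : ℝ) : 0 < P.cl l j ξ x t := Real.exp_pos _

lemma diag_cs (hP : P.Regular) {n : WithTop ℕ∞} (l : ℕ) (ha : CS (n + 1) P.a)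
    (hb : CS n (P.bdiag j)) : CS n (P.diag l j) :=
  hb.sub ((CS.const _).mul ((CS.dT ha).div (ha.mono le_self_add)
    fun x hx t => (hP.a_pos x hx t).ne'))

/-- Differentiating in time raises `l` by one: the derivative of the foot point of the
characteristic contributes the factor `exp ∫ ∂ₜa/a²`. -/
lemma cl_succ (hP : P.Regular) (l : ℕ) (hb : CS 1 (P.bdiag j)) {x₀ x : ℝ}
    (hx₀ : x₀ ∈ Icc (0 : ℝ) 1) (hx : x ∈ Icc (0 : ℝ) 1) (t : ℝ) :
    P.cl (l + 1) j x₀ x t = P.cl l j x₀ x t * deriv (fun t => P.τ j x₀ x t) t := by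
  have fl := hP.flow j hx₀
  have hd : deriv (fun t => P.τ j x₀ x t) t = _ := (fl.inv_td.deriv x hx t).deriv
  rw [hd, hP.cl_eq_amp _ _ hx₀ hx, hP.cl_eq_amp _ _ hx₀ hx, amp, amp, ← Real.exp_neg,
    ← Real.exp_add]
  congr 1
  have hq := hP.slope_cs_one j
  have hdi := hP.diag_cs (n := 1) l (by simpa [one_add_one_eq_two] using hP.a_cs) hb
  rw [← sub_eq_add_neg, ← intervalIntegral.integral_sub]
  · refine intervalIntegral.integral_congr fun η hη => ?_
    have hη' := uIcc_subset_unit hx₀ hx hη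
    have h1 := hP.dT_slope (j := j) hη' (P.τ j η x₀ (P.τ j x₀ x t))
    rw [div_eq_iff (hP.slope_ne_zero j η hη' _)] at h1
    simp only [h1, diag]
    push_cast
    ring
  · exact ((hq.cts.comp fl.td.cts).neg.mul (hdi.cts.comp fl.td.cts)).integrable hx₀ hx _
  · exact (hq.hasPartials.cts'.comp fl.td.cts).integrable hx₀ hx _

lemma cl_add_period (hP : P.Regular) (l : ℕ)
    (hb : ∀ x ∈ Icc (0 : ℝ) 1, ∀ t, P.bdiag j x (t + P.T) = P.bdiag j x t) {x₀ x : ℝ}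
    (hx₀ : x₀ ∈ Icc (0 : ℝ) 1) (hx : x ∈ Icc (0 : ℝ) 1) (t : ℝ) :
    P.cl l j x₀ x (t + P.T) = P.cl l j x₀ x t := by
  rw [Data.cl, Data.cl]
  congr 1
  refine intervalIntegral.integral_congr fun η hη => ?_
  have hη' := uIcc_subset_unit hx hx₀ hη
  have hat : ∀ t, P.at' η (t + P.T) = P.at' η t := dT_add_period hP.a_per η hη'
  simp only [hP.τ_add_period j hx hη', hb η hη', hP.a_per η hη', hat]

end Regular

/-! ### Regularity of the first-order system -/

/-- `(v₁,v₂)` is a continuous `T`-periodic solution of the diagonal system with zero-order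
coefficients `β₁, b₁, β₂, b₂`, right-hand sides `g₁, g₂` and boundary data `h₀, h₁`. -/
structure IsSystemSol (β₁ b₁ g₁ β₂ b₂ g₂ : ℝ → ℝ → ℝ) (h₀ h₁ : ℝ → ℝ) (v₁ v₂ : ℝ → ℝ → ℝ) :
    Prop where
  cts₁ : Cts v₁
  cts₂ : Cts v₂
  per₁ : ∀ x ∈ Icc (0 : ℝ) 1, ∀ t, v₁ x (t + P.T) = v₁ x t
  per₂ : ∀ x ∈ Icc (0 : ℝ) 1, ∀ t, v₂ x (t + P.T) = v₂ x t
  tr₁ : Transport (P.slope 1) (fun ξ s => P.τ 1 ξ 0 s) β₁ b₁ g₁ v₁ v₂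
  tr₂ : Transport (P.slope 2) (fun ξ s => P.τ 2 ξ 1 s) β₂ b₂ g₂ v₂ v₁
  bd₀ : ∀ t, v₁ 0 t = v₂ 0 t + h₀ t
  bd₁ : ∀ t, v₂ 1 t = v₁ 1 t - h₁ t

variable {P}

/-- A continuous solution of the level-`l` system is `C^1` if the loop conditions hold at the levels
`l` and `l + 1`. -/
lemma IsSystemSol.hasPartials (hP : P.Regular) {k l : ℕ} (hl : l + 1 ≤ k) (hnr : P.NonResonant k)
    (hb1 : CS 1 (P.bdiag 1)) (hb2 : CS 1 (P.bdiag 2))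
    (hp1 : ∀ x ∈ Icc (0 : ℝ) 1, ∀ t, P.bdiag 1 x (t + P.T) = P.bdiag 1 x t)
    (hp2 : ∀ x ∈ Icc (0 : ℝ) 1, ∀ t, P.bdiag 2 x (t + P.T) = P.bdiag 2 x t)
    {b₁ g₁ b₂ g₂ v₁ v₂ : ℝ → ℝ → ℝ} {h₀ h₁ : ℝ → ℝ} (hb₁ : CS 1 b₁) (hb₂ : CS 1 b₂)
    (hg₁ : TD g₁) (hg₂ : TD g₂) (hh₀ : ContDiff ℝ 1 h₀) (hh₁ : ContDiff ℝ 1 h₁)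
    (hv : P.IsSystemSol (P.diag l 1) b₁ g₁ (P.diag l 2) b₂ g₂ h₀ h₁ v₁ v₂) :
    HasPartials v₁ (fun x t => -P.slope 1 x t * (P.diag l 1 x t * v₁ x t + b₁ x t * v₂ x t -
        g₁ x t) - P.slope 1 x t * dT v₁ x t) (dT v₁) ∧
      HasPartials v₂ (fun x t => -P.slope 2 x t * (P.diag l 2 x t * v₂ x t + b₂ x t * v₁ x t -
        g₂ x t) - P.slope 2 x t * dT v₂ x t) (dT v₂) := by
  have fl1 := hP.flow 1 zero_mem_unit
  have fl2 := hP.flow 2 one_mem_unit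
  have ha : CS (1 + 1) P.a := by simpa [one_add_one_eq_two] using hP.a_cs
  have hd1 := hP.diag_cs l ha hb1
  have hd2 := hP.diag_cs l ha hb2
  have hK1 := Transport.cts (hP.slope_cs_one 1).cts hd1.cts hb₁.cts hg₁.cts hv.cts₁ hv.cts₂
  have hK2 := Transport.cts (hP.slope_cs_one 2).cts hd2.cts hb₂.cts hg₂.cts hv.cts₂ hv.cts₁
  have hne := hP.slope_one_ne_two
  obtain ⟨Z1, hZ1, e1⟩ := fl1.eq_amp_mul_add fl2 (hP.slope_cs_one 1) (hP.slope_cs_two 2) hne hd1 hb₁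
    hg₁ hv.cts₂ hK2 hv.tr₂ hv.tr₁
  obtain ⟨Z2, hZ2, e2⟩ := fl2.eq_amp_mul_add fl1 (hP.slope_cs_one 2) (hP.slope_cs_two 1)
    (fun x hx t => (hne x hx t).symm) hd2 hb₂ hg₂ hv.cts₁ hK1 hv.tr₁ hv.tr₂
  have c1 : ContDiff ℝ 1 fun t => P.cl l 1 0 1 t := by
    simp_rw [hP.cl_eq_amp l 1 zero_mem_unit one_mem_unit]
    exact (fl1.td_amp (hP.slope_cs_one 1) hd1).contDiff_slice one_mem_unit
  have c2 : ContDiff ℝ 1 fun t => P.cl l 2 1 0 t := by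
    simp_rw [hP.cl_eq_amp l 2 one_mem_unit zero_mem_unit]
    exact (fl2.td_amp (hP.slope_cs_one 2) hd2).contDiff_slice zero_mem_unit
  have y1 : ContDiff ℝ 1 fun t => P.τ 1 0 1 t := fl1.inv_td.contDiff_slice one_mem_unit
  have y2 : ContDiff ℝ 1 fun t => P.τ 2 1 0 t := fl2.inv_td.contDiff_slice zero_mem_unit
  have z1 : ContDiff ℝ 1 fun t => P.τ 1 1 0 t := fl1.td.contDiff_slice one_mem_unit
  have z2 : ContDiff ℝ 1 fun t => P.τ 2 0 1 t := fl2.td.contDiff_slice zero_mem_unit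
  have yz1 : ∀ t, P.τ 1 0 1 (P.τ 1 1 0 t) = t := fl1.inv_left 1 one_mem_unit
  have yz2 : ∀ t, P.τ 2 1 0 (P.τ 2 0 1 t) = t := fl2.inv_left 0 zero_mem_unit
  have y1d : ∀ t, 0 < deriv (fun t => P.τ 1 0 1 t) t := fun t => by
    rw [(fl1.inv_td.deriv 1 one_mem_unit t).deriv]
    exact inv_pos.2 (Real.exp_pos _)
  have y2d : ∀ t, 0 < deriv (fun t => P.τ 2 1 0 t) t := fun t => by
    rw [(fl2.inv_td.deriv 0 zero_mem_unit t).deriv]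
    exact inv_pos.2 (Real.exp_pos _)
  have eA : ∀ t, v₁ 1 t = P.cl l 1 0 1 t * v₂ 0 (P.τ 1 0 1 t) +
      (P.cl l 1 0 1 t * h₀ (P.τ 1 0 1 t) + Z1 1 t) := fun t => by
    rw [e1 1 one_mem_unit t, ← hP.cl_eq_amp l 1 zero_mem_unit one_mem_unit, hv.bd₀]
    ring
  have eB : ∀ t, v₂ 0 t = P.cl l 2 1 0 t * v₁ 1 (P.τ 2 1 0 t) +
      (-(P.cl l 2 1 0 t * h₁ (P.τ 2 1 0 t)) + Z2 0 t) := fun t => by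
    rw [e2 0 zero_mem_unit t, ← hP.cl_eq_amp l 2 one_mem_unit zero_mem_unit, hv.bd₁]
    ring
  have G1 : ContDiff ℝ 1 fun t => P.cl l 1 0 1 t * h₀ (P.τ 1 0 1 t) + Z1 1 t :=
    (c1.mul (hh₀.comp y1)).add (hZ1.contDiff_slice one_mem_unit)
  have G2 : ContDiff ℝ 1 fun t => -(P.cl l 2 1 0 t * h₁ (P.τ 2 1 0 t)) + Z2 0 t :=
    (c2.mul (hh₁.comp y2)).neg.add (hZ2.contDiff_slice zero_mem_unit)
  have s1 : ∀ t, P.cl l 1 0 1 t * deriv (fun t => P.τ 1 0 1 t) t = P.cl (l + 1) 1 0 1 t :=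
    fun t => (hP.cl_succ l hb1 zero_mem_unit one_mem_unit t).symm
  have s2 : ∀ t, P.cl l 2 1 0 t * deriv (fun t => P.τ 2 1 0 t) t = P.cl (l + 1) 2 1 0 t :=
    fun t => (hP.cl_succ l hb2 one_mem_unit zero_mem_unit t).symm
  have p1 := fun t => hP.cl_add_period l hp1 zero_mem_unit one_mem_unit t
  have p2 := fun t => hP.cl_add_period l hp2 one_mem_unit zero_mem_unit t
  have yp1 := fun t => hP.τ_add_period 1 one_mem_unit zero_mem_unit t
  have yp2 := fun t => hP.τ_add_period 2 zero_mem_unit one_mem_unit t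
  have zp1 := fun t => hP.τ_add_period 1 zero_mem_unit one_mem_unit t
  have zp2 := fun t => hP.τ_add_period 2 one_mem_unit zero_mem_unit t
  have hAB : ContDiff ℝ 1 (v₁ 1) ∧ ContDiff ℝ 1 (v₂ 0) := by
    have hA := hv.cts₁.slice_left one_mem_unit
    have hB := hv.cts₂.slice_left zero_mem_unit
    have first : ((∀ t, P.loop₁ l t < 1 ∧ P.loop₁ (l + 1) t < 1) ∨
        ∀ t, 1 < P.loop₁ l t ∧ 1 < P.loop₁ (l + 1) t) → ContDiff ℝ 1 (v₁ 1) ∧ ContDiff ℝ 1 (v₂ 0) :=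
      fun h => contDiff_of_coupled hP.T_pos hA (hv.per₁ 1 one_mem_unit) c1 c2 p1 p2
        (fun t => Regular.cl_pos _ _ _ _ _) (fun t => Regular.cl_pos _ _ _ _ _) y1 y2 z1 z2 yp1 yp2
        zp1 zp2 yz1 yz2 y1d y2d G1 G2 eA eB (by simp only [s1, s2]; exact h)
    have second : ((∀ t, P.loop₂ l t < 1 ∧ P.loop₂ (l + 1) t < 1) ∨
        ∀ t, 1 < P.loop₂ l t ∧ 1 < P.loop₂ (l + 1) t) → ContDiff ℝ 1 (v₂ 0) ∧ ContDiff ℝ 1 (v₁ 1) :=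
      fun h => contDiff_of_coupled hP.T_pos hB (hv.per₂ 0 zero_mem_unit) c2 c1 p2 p1
        (fun t => Regular.cl_pos _ _ _ _ _) (fun t => Regular.cl_pos _ _ _ _ _) y2 y1 z2 z1 yp2 yp1
        zp2 zp1 yz2 yz1 y2d y1d G2 G1 eB eA (by simp only [s1, s2]; exact h)
    rcases hnr with h | h | h | h
    · exact first (Or.inl fun t => ⟨h t l (by omega), h t (l + 1) hl⟩)
    · exact first (Or.inr fun t => ⟨h t l (by omega), h t (l + 1) hl⟩)
    · exact (second (Or.inl fun t => ⟨h t l (by omega), h t (l + 1) hl⟩)).symm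
    · exact (second (Or.inr fun t => ⟨h t l (by omega), h t (l + 1) hl⟩)).symm
  have i1 : ContDiff ℝ 1 (v₁ 0) := by
    rw [show v₁ 0 = fun t => v₂ 0 t + h₀ t from funext hv.bd₀]
    exact hAB.2.add hh₀
  have i2 : ContDiff ℝ 1 (v₂ 1) := by
    rw [show v₂ 1 = fun t => v₁ 1 t - h₁ t from funext hv.bd₁]
    exact hAB.1.sub hh₁
  exact ⟨fl1.hasPartials_of_transport fl2 (hP.slope_cs_one 1) (hP.slope_cs_two 2) hne hd1 hb₁ hg₁
      hv.cts₁ hv.cts₂ hK2 hv.tr₂ hv.tr₁ i1,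
    fl2.hasPartials_of_transport fl1 (hP.slope_cs_one 2) (hP.slope_cs_two 1)
      (fun x hx t => (hne x hx t).symm) hd2 hb₂ hg₂ hv.cts₂ hv.cts₁ hK1 hv.tr₁ hv.tr₂ i2⟩

lemma _root_.TimePeriodicWave.Transport.congr {q Y β β' b g v v' : ℝ → ℝ → ℝ}
    (h : Transport q Y β b g v v') (hβ : ∀ x ∈ Icc (0 : ℝ) 1, ∀ t, β' x t = β x t) :
    Transport q Y β' b g v v' := fun s x hx => by
  rw [hβ x hx]
  exact h s x hx

/-- The right-hand side of the equation for `∂ₜv`, when `v` solves a level-`l` equation with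
right-hand side `g`. -/
noncomputable def derivRhs (P : Data) (l j : ℕ) (b g v v' : ℝ → ℝ → ℝ) (x t : ℝ) : ℝ :=
  dT g x t - dT (P.diag l j) x t * v x t - dT b x t * v' x t -
    dT (P.slope j) x t / P.slope j x t * (P.diag l j x t * v x t + b x t * v' x t - g x t)

lemma Regular.derivRhs_cs (hP : P.Regular) {n : WithTop ℕ∞} {l j : ℕ} {b g v v' : ℝ → ℝ → ℝ}
    (ha : CS (n + 1 + 1) P.a) (hbd : CS (n + 1) (P.bdiag j)) (hb : CS (n + 1) b)
    (hg : CS (n + 1) g) (hv : CS n v) (hv' : CS n v') : CS n (P.derivRhs l j b g v v') := by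
  have hd := hP.diag_cs l ha hbd
  have hq := hP.slope_cs j (ha.mono le_self_add)
  exact (((CS.dT hg).sub ((CS.dT hd).mul hv)).sub ((CS.dT hb).mul hv')).sub
    (((CS.dT hq).div (hq.mono le_self_add) (hP.slope_ne_zero j)).mul
      ((((hd.mono le_self_add).mul hv).add ((hb.mono le_self_add).mul hv')).sub
        (hg.mono le_self_add)))

lemma Regular.diag_succ (hP : P.Regular) (l j : ℕ) : ∀ x ∈ Icc (0 : ℝ) 1, ∀ t,
    P.diag (l + 1) j x t = P.diag l j x t + dT (P.slope j) x t / P.slope j x t := fun x hx t => by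
  rw [hP.dT_slope hx, diag, diag]
  push_cast
  ring

/-- Higher regularity of the system, by induction on `m` over all levels at once: the `t`-derivative
of a solution of the level-`l` system solves the system of level `l + 1`. -/
theorem IsSystemSol.cs (hP : P.Regular) {k : ℕ} (hnr : P.NonResonant k)
    (hp1 : ∀ x ∈ Icc (0 : ℝ) 1, ∀ t, P.bdiag 1 x (t + P.T) = P.bdiag 1 x t)
    (hp2 : ∀ x ∈ Icc (0 : ℝ) 1, ∀ t, P.bdiag 2 x (t + P.T) = P.bdiag 2 x t)
    {b₁ b₂ : ℝ → ℝ → ℝ} (m : ℕ) : ∀ {l : ℕ} {g₁ g₂ v₁ v₂ : ℝ → ℝ → ℝ} {h₀ h₁ : ℝ → ℝ},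
    l + m ≤ k → CS (m + 1 : ℕ) P.a → CS m (P.bdiag 1) → CS m (P.bdiag 2) → CS m b₁ → CS m b₂ →
    CS m g₁ → CS m g₂ → ContDiff ℝ m h₀ → ContDiff ℝ m h₁ →
    P.IsSystemSol (P.diag l 1) b₁ g₁ (P.diag l 2) b₂ g₂ h₀ h₁ v₁ v₂ → CS m v₁ ∧ CS m v₂ := by
  induction m with
  | zero =>
    intro l g₁ g₂ v₁ v₂ h₀ h₁ _ _ _ _ _ _ _ _ _ _ hv
    exact ⟨by simpa using CS.zero_iff.2 hv.cts₁, by simpa using CS.zero_iff.2 hv.cts₂⟩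
  | succ m ih =>
    intro l g₁ g₂ v₁ v₂ h₀ h₁ hl ha hbd1 hbd2 hb₁ hb₂ hg₁ hg₂ hh₀ hh₁ hv
    have hone : (1 : WithTop ℕ∞) ≤ (m + 1 : ℕ) := by exact_mod_cast Nat.le_add_left 1 m
    have hm : ((m : ℕ) : WithTop ℕ∞) ≤ (m + 1 : ℕ) := by exact_mod_cast Nat.le_succ m
    have hm1 : ((m + 1 : ℕ) : WithTop ℕ∞) ≤ (m + 1 + 1 : ℕ) := by exact_mod_cast Nat.le_succ _
    obtain ⟨d1, d2⟩ := hv.hasPartials hP (by omega) hnr (hbd1.mono hone) (hbd2.mono hone) hp1 hp2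
      (hb₁.mono hone) (hb₂.mono hone) (hg₁.mono hone).td (hg₂.mono hone).td (hh₀.of_le hone)
      (hh₁.of_le hone)
    have c1 : CS 1 v₁ := d1.cs
    have c2 : CS 1 v₂ := d2.cs
    obtain ⟨i1, i2⟩ := ih (l := l) (by omega) (ha.mono hm1) (hbd1.mono hm) (hbd2.mono hm)
      (hb₁.mono hm) (hb₂.mono hm) (hg₁.mono hm) (hg₂.mono hm) (hh₀.of_le hm) (hh₁.of_le hm) hv
    have hcast : ∀ {F}, CS (m + 1 : ℕ) F → CS ((m : WithTop ℕ∞) + 1) F := fun h => by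
      exact_mod_cast h
    have ha' : CS ((m : WithTop ℕ∞) + 1 + 1) P.a := by exact_mod_cast ha
    have haone : CS (1 + 1) P.a := by simpa [one_add_one_eq_two] using hP.a_cs
    have hdt1 := (hP.diag_cs l haone (hbd1.mono hone)).td
    have hdt2 := (hP.diag_cs l haone (hbd2.mono hone)).td
    have t1 := (hP.flow 1 zero_mem_unit).transport_dT (hP.slope_cs_two 1) (hP.slope_ne_zero 1) hdt1
      (hb₁.mono hone).td (hg₁.mono hone).td c1.td c2.td hv.tr₁
    have t2 := (hP.flow 2 one_mem_unit).transport_dT (hP.slope_cs_two 2) (hP.slope_ne_zero 2) hdt2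
      (hb₂.mono hone).td (hg₂.mono hone).td c2.td c1.td hv.tr₂
    have hd0 : ∀ {h : ℝ → ℝ}, ContDiff ℝ (m + 1 : ℕ) h →
        ContDiff ℝ m (deriv h) ∧ ∀ t, HasDerivAt h (deriv h t) t := fun {h} hh =>
      ⟨(contDiff_succ_iff_deriv.1 (by exact_mod_cast hh : ContDiff ℝ ((m : WithTop ℕ∞) + 1) h)).2.2,
        fun t => ((hh.of_le hone).differentiable one_ne_zero t).hasDerivAt⟩
    have hv' : P.IsSystemSol (P.diag (l + 1) 1) b₁ (P.derivRhs l 1 b₁ g₁ v₁ v₂)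
        (P.diag (l + 1) 2) b₂ (P.derivRhs l 2 b₂ g₂ v₂ v₁) (deriv h₀) (deriv h₁) (dT v₁) (dT v₂) :=
      { cts₁ := d1.cts'
        cts₂ := d2.cts'
        per₁ := dT_add_period hv.per₁
        per₂ := dT_add_period hv.per₂
        tr₁ := t1.congr (hP.diag_succ l 1)
        tr₂ := t2.congr (hP.diag_succ l 2)
        bd₀ := fun t => by
          have e := ((d2.deriv 0 zero_mem_unit t).add ((hd0 hh₀).2 t)).deriv
          rw [← e]
          exact congrArg (fun f => deriv f t) (funext hv.bd₀)
        bd₁ := fun t => by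
          have e := ((d1.deriv 1 one_mem_unit t).sub ((hd0 hh₁).2 t)).deriv
          rw [← e]
          exact congrArg (fun f => deriv f t) (funext hv.bd₁) }
    obtain ⟨j1, j2⟩ := ih (l := l + 1) (by omega) (ha.mono hm1) (hbd1.mono hm) (hbd2.mono hm)
      (hb₁.mono hm) (hb₂.mono hm)
      (hP.derivRhs_cs ha' (hcast hbd1) (hcast hb₁) (hcast hg₁) i1 i2)
      (hP.derivRhs_cs ha' (hcast hbd2) (hcast hb₂) (hcast hg₂) i2 i1) (hd0 hh₀).1 (hd0 hh₁).1 hv'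
    have q1 := hP.slope_cs 1 (ha.mono (hm.trans hm1))
    have q2 := hP.slope_cs 2 (ha.mono (hm.trans hm1))
    have e1 := hP.diag_cs l (ha'.mono le_self_add) ((hcast hbd1).mono le_self_add)
    have e2 := hP.diag_cs l (ha'.mono le_self_add) ((hcast hbd2).mono le_self_add)
    exact ⟨d1.cs_succ ((q1.neg.mul (((e1.mul i1).add ((hb₁.mono hm).mul i2)).sub
        (hg₁.mono hm))).sub (q1.mul j1)) j1,
      d2.cs_succ ((q2.neg.mul (((e2.mul i2).add ((hb₂.mono hm).mul i1)).sub
        (hg₂.mono hm))).sub (q2.mul j2)) j2⟩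

end Data

/-! ### From weak solutions to the first-order system and back -/

/-- Converse of `linear_ode_eq`. -/
lemma hasDerivWithinAt_of_linear_ode_eq {f A B : ℝ → ℝ} {κ x₀ : ℝ} (hx₀ : x₀ ∈ Icc (0 : ℝ) 1)
    (hA : ContinuousOn A (Icc 0 1)) (hB : ContinuousOn B (Icc 0 1))
    (hf : ∀ x ∈ Icc (0 : ℝ) 1, f x = Real.exp (∫ η in x₀..x, A η) *
      (κ + ∫ ξ in x₀..x, Real.exp (-∫ η in x₀..ξ, A η) * B ξ)) :
    ∀ x ∈ Icc (0 : ℝ) 1, HasDerivWithinAt f (A x * f x + B x) (Icc 0 1) x := by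
  intro x hx
  have hE : ContinuousOn (fun x => Real.exp (-∫ η in x₀..x, A η)) (Icc 0 1) := fun x hx =>
    ((hasDerivWithinAt_integral hA hx₀ hx).neg.exp).continuousWithinAt
  have h1 := ((hasDerivWithinAt_integral hA hx₀ hx).exp.mul
    ((hasDerivWithinAt_integral (hE.mul hB) hx₀ hx).const_add κ)).congr hf (hf x hx)
  refine h1.congr_deriv ?_
  have e : Real.exp (∫ η in x₀..x, A η) * Real.exp (-∫ η in x₀..x, A η) = 1 := by
    rw [← Real.exp_add, add_neg_cancel, Real.exp_zero]
  rw [hf x hx, Pi.mul_apply]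
  linear_combination B x * e

namespace Data

variable {P : Data}

/-- The integral equations along the characteristics are the integrated transport equations. -/
lemma Regular.transport_of_integral_eq (hP : P.Regular) {j : ℕ} {x₀ : ℝ}
    (hx₀ : x₀ ∈ Icc (0 : ℝ) 1) {b g v v' : ℝ → ℝ → ℝ} {κ : ℝ → ℝ} (hβ : Cts (P.bdiag j))
    (hb : Cts b) (hg : Cts g) (hv' : Cts v')
    (h : ∀ x ∈ Icc (0 : ℝ) 1, ∀ t, v x t = P.c j x₀ x t * κ (P.τ j x₀ x t)
      - (∫ ξ in x₀..x, P.d j ξ x t * b ξ (P.τ j ξ x t) * v' ξ (P.τ j ξ x t))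
      + ∫ ξ in x₀..x, P.d j ξ x t * g ξ (P.τ j ξ x t)) :
    Transport (P.slope j) (fun ξ s => P.τ j ξ x₀ s) (P.diag 0 j) b g v v' ∧
      ∀ t, v x₀ t = κ t := by
  have fl := hP.flow j hx₀
  have hY := fl.td.cts
  have hq := (hP.slope_cs_one j).cts
  refine ⟨fun s => ?_, fun t => ?_⟩
  · obtain ⟨A, hAη⟩ : ∃ A : ℝ → ℝ, ∀ η,
        A η = -P.slope j η (P.τ j η x₀ s) * P.bdiag j η (P.τ j η x₀ s) := ⟨_, fun _ => rfl⟩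
    have hA : ContinuousOn A (Icc 0 1) :=
      (((hq.comp hY).neg.mul (hβ.comp hY)).slice_right s).congr fun η _ => hAη η
    have hB : ContinuousOn (fun η => -P.slope j η (P.τ j η x₀ s) * (b η (P.τ j η x₀ s) *
        v' η (P.τ j η x₀ s) - g η (P.τ j η x₀ s))) (Icc 0 1) :=
      ((hq.comp hY).neg.mul (((hb.comp hY).mul (hv'.comp hY)).sub (hg.comp hY))).slice_right s
    have hbg : ∀ {F : ℝ → ℝ → ℝ}, Cts F → ContinuousOn (fun ξ => F ξ (P.τ j ξ x₀ s)) (Icc 0 1) :=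
      fun hF => (hF.comp hY).slice_right s
    intro x hx
    refine (hasDerivWithinAt_of_linear_ode_eq (f := fun ξ => v ξ (P.τ j ξ x₀ s)) (κ := κ s) hx₀
      hA hB (fun x hx => ?_) x hx).congr_deriv (by simp [hAη, diag]; ring)
    have hτ : ∀ ξ ∈ Icc (0 : ℝ) 1, P.τ j ξ x (P.τ j x x₀ s) = P.τ j ξ x₀ s := fun ξ hξ =>
      hP.τ_τ j hx hx₀ hξ s
    have hc : ∀ ξ ∈ Icc (0 : ℝ) 1, P.c j ξ x (P.τ j x x₀ s) =
        Real.exp (∫ η in x₀..x, A η) *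
        Real.exp (-∫ η in x₀..ξ, A η) := by
      intro ξ hξ
      rw [← Real.exp_add, ← sub_eq_add_neg, intervalIntegral.integral_interval_sub_left
        (intervalIntegrable_of_unit hA hx₀ hx) (intervalIntegrable_of_unit hA hx₀ hξ),
        intervalIntegral.integral_symm, ← intervalIntegral.integral_neg, Data.c]
      congr 1
      refine intervalIntegral.integral_congr fun η hη => ?_
      simp only [hτ η (uIcc_subset_unit hx hξ hη), hAη, slope]
      ring
    have hd : ∀ ξ ∈ Icc (0 : ℝ) 1, P.d j ξ x (P.τ j x x₀ s) =
        Real.exp (∫ η in x₀..x, A η) *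
        (Real.exp (-∫ η in x₀..ξ, A η) *
          P.slope j ξ (P.τ j ξ x₀ s)) := by
      intro ξ hξ
      rw [Data.d, hc ξ hξ, hτ ξ hξ, slope]
      ring
    have hE : ContinuousOn (fun ξ => Real.exp (-∫ η in x₀..ξ, A η)) (Icc 0 1) := fun x hx =>
      ((hasDerivWithinAt_integral hA hx₀ hx).neg.exp).continuousWithinAt
    have i1 : ∫ ξ in x₀..x, P.d j ξ x (P.τ j x x₀ s) * b ξ (P.τ j ξ x (P.τ j x x₀ s)) *
        v' ξ (P.τ j ξ x (P.τ j x x₀ s)) =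
        Real.exp (∫ η in x₀..x, A η) *
        ∫ ξ in x₀..x, Real.exp (-∫ η in x₀..ξ, A η) * P.slope j ξ (P.τ j ξ x₀ s) *
          (b ξ (P.τ j ξ x₀ s) * v' ξ (P.τ j ξ x₀ s)) := by
      rw [← intervalIntegral.integral_const_mul]
      refine intervalIntegral.integral_congr fun ξ hξ => ?_
      have hξ' := uIcc_subset_unit hx₀ hx hξ
      simp only [hd ξ hξ', hτ ξ hξ']
      ring
    have i2 : ∫ ξ in x₀..x, P.d j ξ x (P.τ j x x₀ s) * g ξ (P.τ j ξ x (P.τ j x x₀ s)) =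
        Real.exp (∫ η in x₀..x, A η) *
        ∫ ξ in x₀..x, Real.exp (-∫ η in x₀..ξ, A η) * P.slope j ξ (P.τ j ξ x₀ s) * g ξ (P.τ j ξ x₀ s) := by
      rw [← intervalIntegral.integral_const_mul]
      refine intervalIntegral.integral_congr fun ξ hξ => ?_
      have hξ' := uIcc_subset_unit hx₀ hx hξ
      simp only [hd ξ hξ', hτ ξ hξ']
      ring
    have i3 : ∫ ξ in x₀..x, Real.exp (-∫ η in x₀..ξ, A η) * (-P.slope j ξ (P.τ j ξ x₀ s) * (b ξ (P.τ j ξ x₀ s) *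
          v' ξ (P.τ j ξ x₀ s) - g ξ (P.τ j ξ x₀ s))) =
        (∫ ξ in x₀..x, Real.exp (-∫ η in x₀..ξ, A η) * P.slope j ξ (P.τ j ξ x₀ s) * g ξ (P.τ j ξ x₀ s)) -
        ∫ ξ in x₀..x, Real.exp (-∫ η in x₀..ξ, A η) * P.slope j ξ (P.τ j ξ x₀ s) *
          (b ξ (P.τ j ξ x₀ s) * v' ξ (P.τ j ξ x₀ s)) := by
      refine Eq.trans (intervalIntegral.integral_congr fun ξ _ => ?_) (intervalIntegral.integral_sub
        (intervalIntegrable_of_unit ((hE.mul (hbg hq)).mul (hbg hg)) hx₀ hx)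
        (intervalIntegrable_of_unit ((hE.mul (hbg hq)).mul ((hbg hb).mul (hbg hv'))) hx₀ hx))
      ring
    rw [h x hx, i1, i2, i3, hc x₀ hx₀, hτ x₀ hx₀, hP.τ_self j hx₀]
    simp only [intervalIntegral.integral_same, neg_zero, Real.exp_zero]
    ring
  · rw [h x₀ hx₀ t, hP.τ_self j hx₀]
    simp [Data.c]

lemma bdiag_one : P.bdiag 1 = P.b11 := by simp [bdiag]

lemma bdiag_two : P.bdiag 2 = P.b22 := by simp [bdiag]

section WeakSolutions

variable {u₁ u₂ : ℝ → ℝ → ℝ}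

lemma opJ_zero (t : ℝ) : P.opJ u₁ u₂ 0 t = 0 := by simp [opJ]

lemma opF_zero (t : ℝ) : P.opF u₁ u₂ 0 t = P.opG u₁ u₂ t := by simp [opF, opJ_zero]

lemma hasDerivAt_opI (h1 : Cts u₁) (h2 : Cts u₂) (t : ℝ) :
    HasDerivAt (opI u₁ u₂) ((u₁ 0 t + u₂ 0 t) / 2) t := by
  have hc : Continuous fun s => (u₁ 0 s + u₂ 0 s) / 2 :=
    ((h1.slice_left zero_mem_unit).add (h2.slice_left zero_mem_unit)).div_const 2
  exact intervalIntegral.integral_hasDerivAt_right (hc.intervalIntegrable _ _)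
    (hc.stronglyMeasurableAtFilter _ _) hc.continuousAt

lemma hasTDeriv_opG (h1 : Cts u₁) (h2 : Cts u₂) :
    HasTDeriv (fun _ t => P.opG u₁ u₂ t) fun _ t => (u₁ 0 t + u₂ 0 t) / 2 where
  cts := Cts.of_time (continuous_iff_continuousAt.2 fun t =>
    ((hasDerivAt_opI h1 h2 t).add_const _).continuousAt)
  cts' := Cts.of_time (((h1.slice_left zero_mem_unit).add (h2.slice_left zero_mem_unit)).div_const 2)
  deriv _ _ t := (hasDerivAt_opI h1 h2 t).add_const _

lemma Regular.cs_half_inv (hP : P.Regular) {n : WithTop ℕ∞} (ha : CS n P.a) :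
    CS n fun x t => 1 / (2 * P.a x t) :=
  (CS.const 1).div ((CS.const 2).mul ha) fun x hx t => (mul_pos two_pos (hP.a_pos x hx t)).ne'

lemma Regular.cts_opJ_integrand (hP : P.Regular) (h1 : Cts u₁) (h2 : Cts u₂) :
    Cts fun x t => (u₁ x t - u₂ x t) / (2 * P.a x t) :=
  ((hP.cs_half_inv hP.a_cs).cts.mul (h1.sub h2)).congr fun x _ t => by ring

lemma Regular.cts_opF (hP : P.Regular) (h1 : Cts u₁) (h2 : Cts u₂) : Cts (P.opF u₁ u₂) :=
  (hasTDeriv_opG h1 h2).cts.add ((hP.cts_opJ_integrand h1 h2).integral zero_mem_unit)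

/-- `Fu` has a `t`-derivative although `u` is merely continuous: the vertical segments over which
`Ju` integrates are transversal to both families of characteristics. -/
lemma Regular.td_opF (hP : P.Regular) {β₁ b₁ g₁ β₂ b₂ g₂ : ℝ → ℝ → ℝ} {h₀ h₁ : ℝ → ℝ}
    (hv : P.IsSystemSol β₁ b₁ g₁ β₂ b₂ g₂ h₀ h₁ u₁ u₂) (hβ₁ : Cts β₁) (hb₁ : Cts b₁) (hg₁ : Cts g₁)
    (hβ₂ : Cts β₂) (hb₂ : Cts b₂) (hg₂ : Cts g₂) : TD (P.opF u₁ u₂) := by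
  have hc := hP.cs_half_inv (hP.a_cs.mono (by norm_num) : CS 1 P.a)
  have fv := flow_vertical zero_mem_unit
  have t1 := fv.td_integral_transversal (hP.flow 1 zero_mem_unit) (CS.const 0) (hP.slope_cs_two 1)
    (fun x hx t => (hP.slope_ne_zero 1 x hx t).symm) hv.cts₁
    (Transport.cts (hP.slope_cs_one 1).cts hβ₁ hb₁ hg₁ hv.cts₁ hv.cts₂) hv.tr₁ hc zero_mem_unit
  have t2 := fv.td_integral_transversal (hP.flow 2 one_mem_unit) (CS.const 0) (hP.slope_cs_two 2)
    (fun x hx t => (hP.slope_ne_zero 2 x hx t).symm) hv.cts₂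
    (Transport.cts (hP.slope_cs_one 2).cts hβ₂ hb₂ hg₂ hv.cts₂ hv.cts₁) hv.tr₂ hc zero_mem_unit
  refine (TD.add ⟨_, hasTDeriv_opG (P := P) hv.cts₁ hv.cts₂⟩ (t1.sub t2)).congr fun x hx t => ?_
  rw [opF, opJ, ← intervalIntegral.integral_sub ((hc.cts.mul hv.cts₁).integrable zero_mem_unit hx t)
    ((hc.cts.mul hv.cts₂).integrable zero_mem_unit hx t)]
  congr 1
  exact intervalIntegral.integral_congr fun ξ _ => by ring

/-- For a `C^1` solution `u`, the partial derivatives of `Fu`; the two equations of the system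
are compatible with `∂ₜ((u₁ - u₂)/(2a)) = ∂ₓ((u₁ + u₂)/2)`. -/
lemma Regular.hasPartials_opF (hP : P.Regular) {g u₁x u₁t u₂x u₂t : ℝ → ℝ → ℝ}
    (d1 : HasPartials u₁ u₁x u₁t) (d2 : HasPartials u₂ u₂x u₂t)
    (e1 : ∀ x ∈ Icc (0 : ℝ) 1, ∀ t, u₁x x t = -P.slope 1 x t *
      (P.diag 0 1 x t * u₁ x t + P.b12 x t * u₂ x t - g x t) - P.slope 1 x t * u₁t x t)
    (e2 : ∀ x ∈ Icc (0 : ℝ) 1, ∀ t, u₂x x t = -P.slope 2 x t *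
      (P.diag 0 2 x t * u₂ x t + P.b21 x t * u₁ x t - g x t) - P.slope 2 x t * u₂t x t) :
    HasPartials (P.opF u₁ u₂) (fun x t => (u₁ x t - u₂ x t) / (2 * P.a x t))
      (fun x t => (u₁ x t + u₂ x t) / 2) := by
  have ha : HasTDeriv P.a P.at' :=
    (hP.a_cs.mono (by norm_num) : CS 1 P.a).hasPartials.toHasTDeriv
  have hne : ∀ x ∈ Icc (0 : ℝ) 1, ∀ t, 2 * P.a x t ≠ 0 := fun x hx t =>
    (mul_pos two_pos (hP.a_pos x hx t)).ne'
  have hJ := (((d1.toHasTDeriv.sub d2.toHasTDeriv).mul (((HasTDeriv.const 2).mul ha).inv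
    hne)).integral zero_mem_unit)
  have hF := (hasTDeriv_opG (P := P) d1.cts d2.cts).add hJ
  have hctsx := hP.cts_opJ_integrand d1.cts d2.cts
  have hct : Cts fun x t => (u₁ x t + u₂ x t) / 2 :=
    ContinuousOn.div_const (d1.cts.add d2.cts) 2
  refine ⟨⟨hP.cts_opF d1.cts d2.cts, hct, fun x hx t => ?_⟩, hctsx, fun x hx t => ?_⟩
  · have h1 := integral_eq_sub_of_unit (f := fun x => (u₁ x t + u₂ x t) / 2)
      (((d1.ctsx.add d2.ctsx).slice_right t).div_const 2)
      (fun ξ hξ => ((d1.derivx ξ hξ t).add (d2.derivx ξ hξ t)).div_const 2) zero_mem_unit hx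
    have h2 := hF.deriv x hx t
    refine (h2.congr_deriv ?_).congr_of_eventuallyEq (Eventually.of_forall fun s => ?_)
    · rw [← eq_sub_iff_add_eq', ← h1]
      refine intervalIntegral.integral_congr fun ξ hξ => ?_
      have hξ' := uIcc_subset_unit zero_mem_unit hx hξ
      have := (hP.a_pos ξ hξ' t).ne'
      simp only [e1 ξ hξ' t, e2 ξ hξ' t, slope, diag, bdiag_one, bdiag_two, b11, b12, b21, b22]
      norm_num
      field_simp
      ring
    · simp only [opF, opJ, div_eq_mul_inv]
  · exact (hasDerivWithinAt_integral (hctsx.slice_right t) zero_mem_unit hx).const_add _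

/-- `Iu` is periodic: otherwise the boundary condition at `x = 0`, whose other terms are periodic,
would force `a(0,·) r₀` to vanish identically. -/
lemma opI_add_period (h1 : Cts u₁) (h2 : Cts u₂)
    (p1 : ∀ t, u₁ 0 (t + P.T) = u₁ 0 t) (p2 : ∀ t, u₂ 0 (t + P.T) = u₂ 0 t)
    (ha : ∀ t, P.a 0 (t + P.T) = P.a 0 t) (hr : ∀ t, P.r₀ (t + P.T) = P.r₀ t)
    (hC : (∫ t in (0 : ℝ)..P.T, P.a 0 t * P.r₀ t) ≠ 0)
    (hbd : ∀ t, u₁ 0 t = u₂ 0 t + 2 * P.a 0 t * P.r₀ t * P.opG u₁ u₂ t) (t : ℝ) :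
    opI u₁ u₂ (t + P.T) = opI u₁ u₂ t := by
  have hd : ∀ t, HasDerivAt (fun t => opI u₁ u₂ (t + P.T) - opI u₁ u₂ t) 0 t := fun t => by
    have e1 := (hasDerivAt_opI h1 h2 (t + P.T)).comp_add_const t P.T
    exact (e1.sub (hasDerivAt_opI h1 h2 t)).congr_deriv (by rw [p1, p2, sub_self])
  have hconst : ∀ s, opI u₁ u₂ (s + P.T) - opI u₁ u₂ s = opI u₁ u₂ (t + P.T) - opI u₁ u₂ t :=
    fun s => is_const_of_deriv_eq_zero (fun t => (hd t).differentiableAt) (fun t => (hd t).deriv) s t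
  by_contra hne
  refine hC ?_
  have h0 : ∀ s, P.a 0 s * P.r₀ s = 0 := fun s => by
    have e1 := hbd s
    have e2 := hbd (s + P.T)
    rw [p1, p2, ha, hr] at e2
    have e3 := hconst s
    simp only [opG] at e1 e2
    refine (mul_eq_zero.1 (?_ : P.a 0 s * P.r₀ s * (opI u₁ u₂ (t + P.T) - opI u₁ u₂ t) = 0)
      ).resolve_right (sub_ne_zero.2 hne)
    rw [← e3]
    linarith
  simp [h0]

end WeakSolutions

/-- The regularity and periodicity that the coefficients `b_{ij}` inherit. -/
lemma Regular.coefficients (hP : P.Regular) {n : WithTop ℕ∞} (ha : CS (n + 1) P.a)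
    (h1 : IsCT P.T n P.a₁) (h2 : IsCT P.T n P.a₂) :
    CS n P.b11 ∧ CS n P.b12 ∧ CS n P.b21 ∧ CS n P.b22 ∧
    (∀ x ∈ Icc (0 : ℝ) 1, ∀ t, P.b11 x (t + P.T) = P.b11 x t) ∧
    ∀ x ∈ Icc (0 : ℝ) 1, ∀ t, P.b22 x (t + P.T) = P.b22 x t := by
  have ha0 : CS n P.a := ha.mono le_self_add
  have hax : CS n P.ax := CS.dX ha
  have hat : CS n P.at' := CS.dT ha
  have hne : ∀ x ∈ Icc (0 : ℝ) 1, ∀ t, 2 * P.a x t ≠ 0 := fun x hx t =>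
    (mul_pos two_pos (hP.a_pos x hx t)).ne'
  have m2 : CS n fun x t => 2 * P.a x t := (CS.const 2).mul ha0
  have t1 : CS n fun x t => P.a₁ x t / 2 := CS.div h1.1 (CS.const 2) fun _ _ _ => two_ne_zero
  have t2 : CS n fun x t => P.a₂ x t / (2 * P.a x t) := CS.div h2.1 m2 hne
  have t3 : CS n fun x t => (P.a x t * P.ax x t - P.at' x t) / (2 * P.a x t) :=
    ((ha0.mul hax).sub hat).div m2 hne
  have t4 : CS n fun x t => (P.a x t * P.ax x t + P.at' x t) / (2 * P.a x t) :=
    ((ha0.mul hax).add hat).div m2 hne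
  have pat : ∀ x ∈ Icc (0 : ℝ) 1, ∀ t, P.at' x (t + P.T) = P.at' x t := dT_add_period hP.a_per
  have pax : ∀ x ∈ Icc (0 : ℝ) 1, ∀ t, P.ax x (t + P.T) = P.ax x t :=
    dX_add_period hP.a_per
  exact ⟨(t1.add t2).add t3, (t1.sub t2).sub t3, (t1.add t2).add t4, (t1.sub t2).sub t4,
    fun x hx t => by simp only [b11, h1.2 x hx, h2.2 x hx, hP.a_per x hx, pat x hx, pax x hx],
    fun x hx t => by simp only [b22, h1.2 x hx, h2.2 x hx, hP.a_per x hx, pat x hx, pax x hx]⟩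

/-- Finite regularity. Once `u` is `C^1`, the regularity of `Fu`, which enters the right-hand sides,
stays one step ahead of that of `u`. -/
theorem isCT_of_nonResonant (hT : 0 < P.T) (hapos : ∀ x ∈ Icc (0 : ℝ) 1, ∀ t : ℝ, 0 < P.a x t)
    (hC : (∫ t in (0 : ℝ)..P.T, P.a 0 t * P.r₀ t) ≠ 0) {k : ℕ} (hk : 1 ≤ k)
    (ha : IsCT P.T (k + 1 : ℕ) P.a) (ha₁ : IsCT P.T k P.a₁) (ha₂ : IsCT P.T k P.a₂)
    (ha₃ : IsCT P.T k P.a₃) (hf : IsCT P.T k P.f) (hr₀ : IsCTReal P.T k P.r₀)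
    (hr₁ : IsCTReal P.T k P.r₁) (hnr : P.NonResonant k) {w : ℝ → ℝ → ℝ}
    (hw : P.IsWeakSolution w) : IsCT P.T (k + 1 : ℕ) w := by
  have hP : P.Regular := ⟨hT, hapos, CS.mono ha.1 (by exact_mod_cast Nat.succ_le_succ hk), ha.2⟩
  have hone : (1 : WithTop ℕ∞) ≤ (k : ℕ) := by exact_mod_cast hk
  have hcs : CS ((k : WithTop ℕ∞) + 1) P.a := by exact_mod_cast ha.1
  obtain ⟨c11, c12, c21, c22, p11, p22⟩ := hP.coefficients hcs ha₁ ha₂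
  rw [← bdiag_one] at c11 p11
  rw [← bdiag_two] at c22 p22
  obtain ⟨u₁, u₂, hu, hwu⟩ := hw
  have hu1 : Cts u₁ := CS.cts hu.mem₁.1
  have hu2 : Cts u₂ := CS.cts hu.mem₂.1
  set g : ℝ → ℝ → ℝ := fun x t => P.f x t - P.a₃ x t * P.opF u₁ u₂ x t with hg
  have hgc : Cts g := (CS.cts hf.1).sub ((CS.cts ha₃.1).mul (hP.cts_opF hu1 hu2))
  obtain ⟨tr1, bd0⟩ := hP.transport_of_integral_eq (j := 1) (g := g) (b := P.b12) (v := u₁)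
    (v' := u₂) (κ := fun s => u₂ 0 s + 2 * P.a 0 s * P.r₀ s * P.opG u₁ u₂ s) zero_mem_unit
    c11.cts c12.cts hgc hu2 hu.eq₁
  obtain ⟨tr2, bd1⟩ := hP.transport_of_integral_eq (j := 2) (g := g) (b := P.b21) (v := u₂)
    (v' := u₁) (κ := fun s => u₁ 1 s - 2 * P.a 1 s * P.r₁ s * P.opF u₁ u₂ 1 s) one_mem_unit
    c22.cts c21.cts hgc hu1 hu.eq₂
  have hsys : P.IsSystemSol (P.diag 0 1) P.b12 g (P.diag 0 2) P.b21 g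
      (fun t => 2 * P.a 0 t * P.r₀ t * P.opF u₁ u₂ 0 t)
      (fun t => 2 * P.a 1 t * P.r₁ t * P.opF u₁ u₂ 1 t) u₁ u₂ :=
    ⟨hu1, hu2, hu.mem₁.2, hu.mem₂.2, tr1, tr2, fun t => by rw [bd0 t, opF_zero], bd1⟩
  have hd1 := hP.diag_cs 0 hcs c11
  have hd2 := hP.diag_cs 0 hcs c22
  have hak : CS k P.a := hcs.mono le_self_add
  have hbdry : ∀ {n : WithTop ℕ∞} {r : ℝ → ℝ} {x : ℝ}, n ≤ k → x ∈ Icc (0 : ℝ) 1 →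
      ContDiff ℝ k r → ContDiff ℝ n (P.opF u₁ u₂ x) →
      ContDiff ℝ n fun t => 2 * P.a x t * r t * P.opF u₁ u₂ x t :=
    fun hn hx hr hF => (((contDiff_const.mul (hak.slice hx)).mul hr).of_le hn).mul hF
  have hFtd : TD (P.opF u₁ u₂) :=
    hP.td_opF hsys hd1.cts c12.cts hgc hd2.cts c21.cts hgc
  have hgtd : TD g := (CS.mono hf.1 hone).td.sub ((CS.mono ha₃.1 hone).td.mul hFtd)
  obtain ⟨D1, D2⟩ := hsys.hasPartials hP (by omega) hnr (c11.mono hone) (c22.mono hone) p11 p22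
    (c12.mono hone) (c21.mono hone) hgtd hgtd
    (hbdry hone zero_mem_unit hr₀.1 (hFtd.contDiff_slice zero_mem_unit))
    (hbdry hone one_mem_unit hr₁.1 (hFtd.contDiff_slice one_mem_unit))
  have hFp := hP.hasPartials_opF D1 D2 (fun _ _ _ => rfl) (fun _ _ _ => rfl)
  have hFsucc : ∀ {m : ℕ}, m ≤ k → CS m u₁ → CS m u₂ → CS (m + 1 : ℕ) (P.opF u₁ u₂) :=
    fun {m} hm h1 h2 => hFp.cs_succ
      (((hP.cs_half_inv (hak.mono (by exact_mod_cast hm))).mul (h1.sub h2)).congr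
        fun x _ t => by ring)
      ((h1.add h2).div (CS.const 2) fun _ _ _ => two_ne_zero)
  have hu : ∀ m : ℕ, m + 1 ≤ k → CS (m + 1 : ℕ) u₁ ∧ CS (m + 1 : ℕ) u₂ := fun m => by
    induction m with
    | zero => exact fun _ => ⟨by exact_mod_cast D1.cs, by exact_mod_cast D2.cs⟩
    | succ m ih =>
      intro hm
      obtain ⟨i1, i2⟩ := ih (by omega)
      have hF := hFsucc (by omega) i1 i2
      have hmk : ((m + 1 + 1 : ℕ) : WithTop ℕ∞) ≤ (k : ℕ) := by exact_mod_cast hm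
      have hgm : CS (m + 1 + 1 : ℕ) g := (CS.mono hf.1 hmk).sub ((CS.mono ha₃.1 hmk).mul hF)
      exact IsSystemSol.cs hP hnr p11 p22 (m + 1 + 1) (by omega)
        (CS.mono ha.1 (by exact_mod_cast Nat.succ_le_succ hm)) (c11.mono hmk) (c22.mono hmk)
        (c12.mono hmk) (c21.mono hmk) hgm hgm (hbdry hmk zero_mem_unit hr₀.1 (hF.slice zero_mem_unit))
        (hbdry hmk one_mem_unit hr₁.1 (hF.slice one_mem_unit)) hsys
  obtain ⟨m, rfl⟩ : ∃ m, k = m + 1 := ⟨k - 1, by omega⟩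
  obtain ⟨i1, i2⟩ := hu m le_rfl
  have hwF : ∀ x ∈ Icc (0 : ℝ) 1, ∀ t, w x t = P.opF u₁ u₂ x t := fun x hx t => by
    rw [hwu x hx t, opF, opG]
    ring
  refine ⟨(hFsucc le_rfl i1 i2).congr hwF, fun x hx t => ?_⟩
  have hI := opI_add_period hu1 hu2 (hsys.per₁ 0 zero_mem_unit) (hsys.per₂ 0 zero_mem_unit)
    (ha.2 0 zero_mem_unit) hr₀.2 hC bd0 t
  have hJ : P.opJ u₁ u₂ x (t + P.T) = P.opJ u₁ u₂ x t :=
    intervalIntegral.integral_congr fun ξ hξ => by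
      have hξ' := uIcc_subset_unit zero_mem_unit hx hξ
      simp only [hsys.per₁ ξ hξ', hsys.per₂ ξ hξ', ha.2 ξ hξ']
  rw [hwu x hx, hwu x hx, hI, hJ]

/-! ### Time-independent wave speed -/

lemma cl_eq_of_time_independent (h : ∀ x ∈ Icc (0 : ℝ) 1, ∀ s t : ℝ, P.a x s = P.a x t)
    (l j : ℕ) {x ξ : ℝ} (hx : x ∈ Icc (0 : ℝ) 1) (hξ : ξ ∈ Icc (0 : ℝ) 1) (t : ℝ) :
    P.cl l j ξ x t = Real.exp (∫ η in x..ξ, (-1 : ℝ) ^ j *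
      (P.bdiag j η (P.τ j η x t) / P.a η (P.τ j η x t))) := by
  rw [cl]
  congr 1
  refine intervalIntegral.integral_congr fun η hη => ?_
  have h0 : ∀ t, P.at' η t = 0 := fun t => by
    rw [at', show (fun s => P.a η s) = fun _ => P.a η 0 from
      funext fun s => h η (uIcc_subset_unit hx hξ hη) s 0, deriv_const]
  simp only [h0]
  ring

/-- A continuous function that avoids the value `1` stays on one side of it. -/
lemma lt_one_or_one_lt {f : ℝ → ℝ} (hf : Continuous f) (h : ∀ t, f t ≠ 1) :
    (∀ t, f t < 1) ∨ ∀ t, 1 < f t := by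
  by_contra hcon
  push Not at hcon
  obtain ⟨⟨s, hs⟩, t, ht⟩ := hcon
  obtain ⟨r, hr⟩ := mem_range_of_exists_le_of_exists_ge hf ⟨t, ht⟩ ⟨s, hs⟩
  exact h r hr

lemma Regular.continuous_cl (hP : P.Regular) {j : ℕ} (hb : CS 1 (P.bdiag j)) {x₀ x : ℝ}
    (hx₀ : x₀ ∈ Icc (0 : ℝ) 1) (hx : x ∈ Icc (0 : ℝ) 1) : Continuous fun t => P.cl 0 j x₀ x t := by
  simp_rw [hP.cl_eq_amp 0 j hx₀ hx]
  exact (((hP.flow j hx₀).td_amp (hP.slope_cs_one j)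
    (hP.diag_cs 0 (by simpa [one_add_one_eq_two] using hP.a_cs) hb)).contDiff_slice hx).continuous

/-- For a time-independent wave speed all levels `l` give the same loop factor, the exponential of
the integral in the condition. -/
lemma Regular.nonResonant (hP : P.Regular) (h : ∀ x ∈ Icc (0 : ℝ) 1, ∀ s t : ℝ, P.a x s = P.a x t)
    (hb1 : CS 1 P.b11) (hb2 : CS 1 P.b22) (hs : P.Small ∨ P.SmallPlus) (k : ℕ) :
    P.NonResonant k := by
  rw [← bdiag_one] at hb1
  rw [← bdiag_two] at hb2
  have fl1 := hP.flow 1 zero_mem_unit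
  have fl2 := hP.flow 2 one_mem_unit
  have l1 : ∀ l t, P.loop₁ l t = P.loop₁ 0 t := fun l t => by
    simp only [loop₁, cl_eq_of_time_independent h _ _ one_mem_unit zero_mem_unit,
      cl_eq_of_time_independent h _ _ zero_mem_unit one_mem_unit]
  have l2 : ∀ l t, P.loop₂ l t = P.loop₂ 0 t := fun l t => by
    simp only [loop₂, cl_eq_of_time_independent h _ _ one_mem_unit zero_mem_unit,
      cl_eq_of_time_independent h _ _ zero_mem_unit one_mem_unit]
  have i : ∀ {j : ℕ}, CS 1 (P.bdiag j) → ∀ {x₀ : ℝ}, x₀ ∈ Icc (0 : ℝ) 1 → ∀ t,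
      IntervalIntegrable (fun η => P.bdiag j η (P.τ j η x₀ t) / P.a η (P.τ j η x₀ t)) volume 0 1 :=
    fun {j} hb x₀ hx₀ t => intervalIntegrable_of_unit
      ((((hb.div (hP.a_cs.mono (by norm_num)) fun x hx t => (hP.a_pos x hx t).ne').cts).comp
        (hP.flow j hx₀).td.cts).slice_right t) zero_mem_unit one_mem_unit
  have e1 : ∀ t, P.cl 0 1 0 1 t = Real.exp (∫ η in (0 : ℝ)..1,
      P.b11 η (P.τ 1 η 1 t) / P.a η (P.τ 1 η 1 t)) := fun t => by
    rw [cl_eq_of_time_independent h _ _ one_mem_unit zero_mem_unit, intervalIntegral.integral_symm,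
      ← intervalIntegral.integral_neg]
    simp [bdiag_one]
  have e2 : ∀ t, P.cl 0 2 1 0 t = Real.exp (∫ η in (0 : ℝ)..1,
      P.b22 η (P.τ 2 η 0 t) / P.a η (P.τ 2 η 0 t)) := fun t => by
    rw [cl_eq_of_time_independent h _ _ zero_mem_unit one_mem_unit]
    simp [bdiag_two]
  have i1 := fun t => i hb1 one_mem_unit t
  have i2 := fun t => i hb2 zero_mem_unit t
  simp only [bdiag_one] at i1
  simp only [bdiag_two] at i2
  have c1 := hP.continuous_cl hb1 zero_mem_unit one_mem_unit
  have c2 := hP.continuous_cl hb2 one_mem_unit zero_mem_unit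
  rcases hs with hs | hs
  · have hne : ∀ t, P.loop₁ 0 t ≠ 1 := fun t => by
      rw [loop₁, e1, e2, ← Real.exp_add, ← intervalIntegral.integral_add (i1 _) (i2 _), Ne,
        Real.exp_eq_one_iff]
      exact hs t
    have hc : Continuous (P.loop₁ 0) :=
      c1.mul (c2.comp (fl1.inv_td.contDiff_slice one_mem_unit).continuous)
    rcases lt_one_or_one_lt hc hne with h' | h'
    · exact Or.inl fun t l _ => by rw [l1]; exact h' t
    · exact Or.inr (Or.inl fun t l _ => by rw [l1]; exact h' t)
  · have hne : ∀ t, P.loop₂ 0 t ≠ 1 := fun t => by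
      rw [loop₂, e1, e2, ← Real.exp_add, ← intervalIntegral.integral_add (i2 _) (i1 _), Ne,
        Real.exp_eq_one_iff]
      exact hs t
    have hc : Continuous (P.loop₂ 0) :=
      c2.mul (c1.comp (fl2.inv_td.contDiff_slice zero_mem_unit).continuous)
    rcases lt_one_or_one_lt hc hne with h' | h'
    · exact Or.inr (Or.inr (Or.inl fun t l _ => by rw [l2]; exact h' t))
    · exact Or.inr (Or.inr (Or.inr fun t l _ => by rw [l2]; exact h' t))

end Data

end TimePeriodicWave

theorem theorem1p3 (P : TimePeriodicWave.Data) (hT : 0 < P.T)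
    (ha : ∀ x ∈ Icc (0 : ℝ) 1, ∀ t : ℝ, 0 < P.a x t)
    (hC : (∫ t in (0 : ℝ)..P.T, P.a 0 t * P.r₀ t) ≠ 0) :
    (∀ k : ℕ, 1 ≤ k →
      TimePeriodicWave.IsCT P.T (k + 1 : ℕ) P.a →
      TimePeriodicWave.IsCT P.T k P.a₁ → TimePeriodicWave.IsCT P.T k P.a₂ →
      TimePeriodicWave.IsCT P.T k P.a₃ → TimePeriodicWave.IsCT P.T k P.f →
      TimePeriodicWave.IsCTReal P.T k P.r₀ → TimePeriodicWave.IsCTReal P.T k P.r₁ →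
      P.NonResonant k →
      ∀ w : ℝ → ℝ → ℝ, P.IsWeakSolution w → TimePeriodicWave.IsCT P.T (k + 1 : ℕ) w) ∧
    ((∀ x ∈ Icc (0 : ℝ) 1, ∀ s t : ℝ, P.a x s = P.a x t) →
      TimePeriodicWave.IsCT P.T ∞ P.a →
      TimePeriodicWave.IsCT P.T ∞ P.a₁ → TimePeriodicWave.IsCT P.T ∞ P.a₂ →
      TimePeriodicWave.IsCT P.T ∞ P.a₃ → TimePeriodicWave.IsCT P.T ∞ P.f →
      TimePeriodicWave.IsCTReal P.T ∞ P.r₀ → TimePeriodicWave.IsCTReal P.T ∞ P.r₁ →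
      (P.Small ∨ P.SmallPlus) →
      ∀ w : ℝ → ℝ → ℝ, P.IsWeakSolution w → TimePeriodicWave.IsCT P.T ∞ w) := by
  refine ⟨fun k hk hak ha₁ ha₂ ha₃ hf hr₀ hr₁ hnr w hw =>
    TimePeriodicWave.Data.isCT_of_nonResonant hT ha hC hk hak ha₁ ha₂ ha₃ hf hr₀ hr₁ hnr hw,
    fun hind hai ha₁ ha₂ ha₃ hf hr₀ hr₁ hs w hw => ?_⟩
  have hle : ∀ n : ℕ, (n : WithTop ℕ∞) ≤ (∞ : WithTop ℕ∞) := fun n => by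
    exact_mod_cast (le_top : (n : ℕ∞) ≤ ⊤)
  have hP : P.Regular := ⟨hT, ha, hai.1.of_le (hle 2), hai.2⟩
  have hCT : ∀ {u : ℝ → ℝ → ℝ}, TimePeriodicWave.IsCT P.T ∞ u → ∀ n : ℕ,
      TimePeriodicWave.IsCT P.T n u := fun hu n => ⟨hu.1.of_le (hle n), hu.2⟩
  have hCTR : ∀ {r : ℝ → ℝ}, TimePeriodicWave.IsCTReal P.T ∞ r → ∀ n : ℕ,
      TimePeriodicWave.IsCTReal P.T n r := fun hr n => ⟨hr.1.of_le (hle n), hr.2⟩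
  have hco := hP.coefficients (n := 1) (hai.1.of_le (by exact_mod_cast hle 2))
    (by exact_mod_cast hCT ha₁ 1) (by exact_mod_cast hCT ha₂ 1)
  have key : ∀ n : ℕ, TimePeriodicWave.IsCT P.T (n + 1 + 1 : ℕ) w := fun n =>
    TimePeriodicWave.Data.isCT_of_nonResonant hT ha hC (Nat.le_add_left 1 n) (hCT hai _)
      (hCT ha₁ _) (hCT ha₂ _) (hCT ha₃ _) (hCT hf _) (hCTR hr₀ _) (hCTR hr₁ _)
      (hP.nonResonant hind hco.1 hco.2.2.2.1 hs _) hw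
  exact ⟨contDiffOn_infty.2 fun n => (key n).1.of_le
    (by exact_mod_cast Nat.le_add_right n 2), (key 0).2⟩
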